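/- **Conventions.** Let $\Phi$ be a real $m\times N$ matrix, $m\le N$, with columns $\phi_1,\dots,\phi_N$ of unit Euclidean norm. Put $\mu_{i,j}=|\langle\phi_i,\phi_j\rangle|$, $\mu=\max_{i\ne j}\mu_{i,j}$ and $\bar\mu^2=\max_{1\le j\le N}\frac1{N-1}\sum_{i\ne j}\mu_{i,j}^2$, and let $\|\Phi\|$ be the spectral norm. A random vector $x\in\mathbb R^N$ is drawn from the generic random signal model $\mathcal S_k$ if (1) the set $I$ of locations of its $k$ coordinates of largest magnitude is uniformly distributed on the $k$-subsets of $\{1,\dots,N\}$, and (2) conditionally on $I$, the signs of the coordinates $x_i$, $i\in I$, are independent and uniform on $\{1,-1\}$; nothing is assumed about the magnitudes. Basis Pursuit recovers $x$ if $x$ is the unique minimizer of $\|z\|_1$ over all $z\in\mathbb R^N$ with $\Phi z=\Phi x$. **Proposition.** Suppose that $$\mu=O(m^{-1/4}),\qquad \bar\mu^2=O(1/m),\qquad \|\Phi\|=O\big(\sqrt{N/k}\big),\qquad m=\Theta\big(k\,(\log (N/\epsilon))^3\big),$$ and $k<1/\epsilon$, where $k\ge1$ and $\epsilon>0$. Then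 for all sufficiently large $N$, if $x$ is drawn from $\mathcal S_k$ and is almost surely $k$-sparse (at most $k$ nonzero coordinates), Basis Pursuit recovers $x$ except on an event of probability at most $\epsilon$. Precisely: for all real constants $C_1,C_2,C_3,C$ and $c>0$ there is $N_0$ such that for all $N\ge N_0$, all $m\le N$, $k\ge1$, $\epsilon>0$ with $k<1/\epsilon$ and $c\,k(\log(N/\epsilon))^3\le m\le C\,k(\log(N/\epsilon))^3$, and every $\Phi$ as above with $\mu\le C_1m^{-1/4}$, $\bar\mu^2\le C_2/m$ and $\|\Phi\|\le C_3\sqrt{N/k}$, every $k$-sparse random signal $x$ from $\mathcal S_k$ is recovered by Basis Pursuit with probability at least $1-\epsilon$. -/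

import Mathlib

open MeasureTheory ProbabilityTheory

namespace SparseRecovery

noncomputable section

/-- All columns `φ_j` of `Φ` have unit Euclidean norm. -/
def UnitNormColumns {m N : ℕ} (Φ : Matrix (Fin m) (Fin N) ℝ) : Prop :=
  ∀ j, ‖WithLp.toLp 2 (Φ.col j)‖ = 1

/-- The coherence `μ_{i,j} = |⟨φ_i, φ_j⟩|` of two columns. -/
def pairCoherence {m N : ℕ} (Φ : Matrix (Fin m) (Fin N) ℝ) (i j : Fin N) : ℝ :=
  |Φ.col i ⬝ᵥ Φ.col j|

/-- The mutual coherence `μ = max_{i ≠ j} μ_{i,j}`. -/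
def mutualCoherence {m N : ℕ} (Φ : Matrix (Fin m) (Fin N) ℝ) : ℝ :=
  ⨆ p : {p : Fin N × Fin N // p.1 ≠ p.2}, pairCoherence Φ p.1.1 p.1.2

/-- The mean square coherence `max_j (N - 1)⁻¹ ∑_{i ≠ j} μ_{i,j}²`. -/
def meanSquareCoherence {m N : ℕ} (Φ : Matrix (Fin m) (Fin N) ℝ) : ℝ :=
  ⨆ j : Fin N, 1 / ((N : ℝ) - 1) * ∑ i ∈ Finset.univ.erase j, pairCoherence Φ i j ^ 2

/-- The spectral norm `‖Φ‖`: the operator norm between Euclidean spaces. -/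
def specNorm {m N : ℕ} (Φ : Matrix (Fin m) (Fin N) ℝ) : ℝ :=
  ‖(Matrix.toEuclideanLin Φ).toContinuousLinearMap‖

/-- The `ℓ₁` norm on `ℝ^N`. -/
def l1norm {N : ℕ} (z : Fin N → ℝ) : ℝ := ∑ i, |z i|

/-- The set of outputs of Basis Pursuit on the sketch `y`: all minimizers of `‖z‖₁` subject to
`Φ z = y`. -/
def basisPursuit {m N : ℕ} (Φ : Matrix (Fin m) (Fin N) ℝ) (y : Fin m → ℝ) : Set (Fin N → ℝ) :=
  {z | Φ.mulVec z = y ∧ ∀ w, Φ.mulVec w = y → l1norm z ≤ l1norm w}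

/-- Basis Pursuit recovers `x` from its sketch `Φ x`: the minimizer is unique and equal to `x`. -/
def BPRecovers {m N : ℕ} (Φ : Matrix (Fin m) (Fin N) ℝ) (x : Fin N → ℝ) : Prop :=
  basisPursuit Φ (Φ.mulVec x) = {x}

/-- `x` has at most `k` nonzero coordinates. -/
def IsSparse {N : ℕ} (k : ℕ) (x : Fin N → ℝ) : Prop :=
  (Finset.univ.filter fun i => x i ≠ 0).card ≤ k

/-- The random vector `x` is drawn from the generic random signal model `S_k`. The random set `I` is
the set of locations of the `k` coordinates of largest magnitude (chosen in some way when there are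
ties). It is uniform on the `k`-subsets, and conditionally on `I = J` the signs of `x_i`, `i ∈ J`,
are independent and uniform on `{1, -1}`. Nothing is assumed about the magnitudes. -/
def IsGenericRandomSignal {Ω : Type*} [MeasurableSpace Ω] (P : Measure Ω) {N : ℕ} (k : ℕ)
    (x : Ω → Fin N → ℝ) : Prop :=
  Measurable x ∧
  ∃ I : Ω → Finset (Fin N),
    (∀ J, MeasurableSet {ω | I ω = J}) ∧
    (∀ᵐ ω ∂P, (I ω).card = k ∧ ∀ i ∈ I ω, ∀ j ∉ I ω, |x ω j| ≤ |x ω i|) ∧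
    ∀ J : Finset (Fin N), J.card = k →
      P {ω | I ω = J} = (N.choose k : ENNReal)⁻¹ ∧
      iIndepFun (fun (i : J) (ω : Ω) => Real.sign (x ω i)) (cond P {ω | I ω = J}) ∧
      ∀ i ∈ J, cond P {ω | I ω = J} {ω | Real.sign (x ω i) = 1} = 2⁻¹ ∧
        cond P {ω | I ω = J} {ω | Real.sign (x ω i) = -1} = 2⁻¹

end

end SparseRecovery

/-! Condition on the support `J` and let L = log(N/ε). Recovery follows from a dual certificate: the
least-squares vector h = Φ_J (Φ_Jᵀ Φ_J)⁻¹ s, with s the signs on `J`, must satisfy |⟨φ_j, h⟩| < 1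
off `J` (`bpRecovers_of_certificate`). If Φ_Jᵀ Φ_J ≥ 1/2 and ∑_{i ∈ J} ⟨φ_j, φ_i⟩² ≤ 1/(5000 L) for
j ∉ J, each ⟨φ_j, h⟩ is a Rademacher sum with coefficient vector of squared length at most 4/(5000
L). Hoeffding's inequality and a union bound over j then suffice. What remains is to show that few
k-subsets violate `WellConditioned`.

The counting tool is a moment bound for S_I = ∑_{i ∈ I} x_i x_iᵀ over k-subsets I
(`sum_trace_sampleGram_pow_le`). In tr S_I^{p+1} = ∑_{i ∈ I} x_iᵀ S_I^p x_i the rank-one term x_i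
x_iᵀ inside S_I may be replaced by r · 1 when |x_i|² ≤ r (`quadForm_pow_add_vecMulVec_le`). Then x_i
no longer interacts with the remaining set, and averaging over i gives a recursion in p and k.
Moments of order about 4L yield failure proportions of order N e^{-4L}.

For Φ_Jᵀ Φ_J only a lower bound is needed, so the Gram matrix is replaced by a smaller one, with
spectrum cut at κ = N/(1000 k). By the mean square coherence the cut costs little on the diagonal,
and the off-diagonal part Y acquires a norm bound of order κ (`exists_hollow_minorant`). The form of
Y on I is four times the average of its bipartite pieces between B ⊆ I and I \ B. With B fixed, I \
B is a random subset of the complement, so the moment bound applies to the rows of Y restricted to B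
(`card_regular_large_quadForm_mul_pow_le`). Its inputs, short rows and bounded columns on B, come
from two further uses of the same moment bound. -/

namespace SparseRecovery

/-! ### Spectral calculus for positive semidefinite matrices and the rank-one comparison. -/

section Spectral

open Matrix

variable {n : Type*} [Fintype n] [DecidableEq n]

theorem exists_orthogonal_diagonalization {A : Matrix n n ℝ} (hA : A.PosSemidef) :
    ∃ (U : Matrix n n ℝ) (d : n → ℝ), Uᵀ * U = 1 ∧ U * Uᵀ = 1 ∧ (∀ i, 0 ≤ d i) ∧
      A = U * diagonal d * Uᵀ := by
  refine ⟨(hA.1.eigenvectorUnitary : Matrix n n ℝ), hA.1.eigenvalues, ?_, ?_,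
    hA.eigenvalues_nonneg, ?_⟩
  · have := (Matrix.mem_unitaryGroup_iff').1 hA.1.eigenvectorUnitary.2
    simpa [star_eq_conjTranspose] using this
  · have := (Matrix.mem_unitaryGroup_iff).1 hA.1.eigenvectorUnitary.2
    simpa [star_eq_conjTranspose] using this
  · have := hA.1.spectral_theorem
    simpa [Unitary.conjStarAlgAut_apply, star_eq_conjTranspose, Function.comp_def] using this

theorem conj_diagonal_pow {U : Matrix n n ℝ} (hU : Uᵀ * U = 1) (hU' : U * Uᵀ = 1) (d : n → ℝ)
    (p : ℕ) : (U * diagonal d * Uᵀ) ^ p = U * diagonal (fun i => d i ^ p) * Uᵀ := by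
  induction p with
  | zero => simp [hU']
  | succ p ih =>
    rw [pow_succ, ih]
    calc U * diagonal (fun i => d i ^ p) * Uᵀ * (U * diagonal d * Uᵀ)
        = U * diagonal (fun i => d i ^ p) * (Uᵀ * U) * diagonal d * Uᵀ := by
          simp only [Matrix.mul_assoc]
      _ = _ := by
          rw [hU, Matrix.mul_one, Matrix.mul_assoc U, diagonal_mul_diagonal]
          simp only [pow_succ]

theorem conj_diagonal_mul {U : Matrix n n ℝ} (hU : Uᵀ * U = 1) (d e : n → ℝ) :
    (U * diagonal d * Uᵀ) * (U * diagonal e * Uᵀ) = U * diagonal (fun i => d i * e i) * Uᵀ := by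
  calc U * diagonal d * Uᵀ * (U * diagonal e * Uᵀ)
      = U * diagonal d * (Uᵀ * U) * diagonal e * Uᵀ := by simp only [Matrix.mul_assoc]
    _ = _ := by rw [hU, Matrix.mul_one, Matrix.mul_assoc U, diagonal_mul_diagonal]

theorem conj_diagonal_quadForm (U : Matrix n n ℝ) (d x : n → ℝ) :
    x ⬝ᵥ (U * diagonal d * Uᵀ) *ᵥ x = ∑ i, d i * (Uᵀ *ᵥ x) i ^ 2 := by
  rw [← mulVec_mulVec, ← mulVec_mulVec, dotProduct_mulVec, ← mulVec_transpose]
  simp only [dotProduct, mulVec_diagonal]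
  exact Finset.sum_congr rfl fun i _ => by ring

theorem orthogonal_dotProduct {U : Matrix n n ℝ} (hU' : U * Uᵀ = 1) (x : n → ℝ) :
    x ⬝ᵥ x = ∑ i, (Uᵀ *ᵥ x) i ^ 2 := by
  have := conj_diagonal_quadForm U (fun _ => 1) x
  simpa [hU'] using this

theorem conj_diagonal_trace {U : Matrix n n ℝ} (hU : Uᵀ * U = 1) (d : n → ℝ) :
    (U * diagonal d * Uᵀ).trace = ∑ i, d i := by
  rw [Matrix.mul_assoc, trace_mul_comm, Matrix.mul_assoc, hU, Matrix.mul_one, trace_diagonal]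

theorem conj_diagonal_add_smul_one {U : Matrix n n ℝ} (hU' : U * Uᵀ = 1) (d : n → ℝ) (r : ℝ) :
    U * diagonal d * Uᵀ + r • 1 = U * diagonal (fun i => d i + r) * Uᵀ := by
  have : diagonal (fun i => d i + r) = diagonal d + r • (1 : Matrix n n ℝ) := by
    rw [smul_one_eq_diagonal, diagonal_add]
  rw [this, Matrix.mul_add, Matrix.add_mul, Matrix.mul_smul, Matrix.smul_mul, Matrix.mul_one, hU']

/-- Chebyshev's association inequality for the spectral measure of `A` at `x`. -/
theorem quadForm_mul_quadForm_le {A : Matrix n n ℝ} (hA : A.PosSemidef) {r : ℝ} (hr : 0 ≤ r)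
    (a b : ℕ) (x : n → ℝ) :
    (x ⬝ᵥ (A ^ a) *ᵥ x) * (x ⬝ᵥ ((A + r • 1) ^ b) *ᵥ x) ≤
      (x ⬝ᵥ x) * (x ⬝ᵥ (A ^ a * (A + r • 1) ^ b) *ᵥ x) := by
  obtain ⟨U, d, hU, hU', hd, rfl⟩ := exists_orthogonal_diagonalization hA
  rw [conj_diagonal_add_smul_one hU', conj_diagonal_pow hU hU', conj_diagonal_pow hU hU',
    conj_diagonal_mul hU, conj_diagonal_quadForm, conj_diagonal_quadForm, conj_diagonal_quadForm,
    orthogonal_dotProduct hU']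
  set w := fun i => (Uᵀ *ᵥ x) i ^ 2 with hw
  have hw0 : ∀ i, 0 ≤ w i := fun i => sq_nonneg _
  -- Both powers increase along the spectrum, so the two differences always have the same sign.
  have key : 0 ≤ ∑ i, ∑ j, w i * w j *
      ((d i ^ a - d j ^ a) * ((d i + r) ^ b - (d j + r) ^ b)) := by
    refine Finset.sum_nonneg fun i _ => Finset.sum_nonneg fun j _ =>
      mul_nonneg (mul_nonneg (hw0 i) (hw0 j)) ?_
    rcases le_total (d i) (d j) with h | h
    · refine mul_nonneg_of_nonpos_of_nonpos ?_ ?_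
      · exact sub_nonpos.2 (pow_le_pow_left₀ (hd i) h a)
      · exact sub_nonpos.2 (pow_le_pow_left₀ (by linarith [hd i]) (by linarith) b)
    · refine mul_nonneg ?_ ?_
      · exact sub_nonneg.2 (pow_le_pow_left₀ (hd j) h a)
      · exact sub_nonneg.2 (pow_le_pow_left₀ (by linarith [hd j]) (by linarith) b)
  have e : ∑ i, ∑ j, w i * w j * ((d i ^ a - d j ^ a) * ((d i + r) ^ b - (d j + r) ^ b)) =
      2 * ((∑ i, w i) * ∑ i, d i ^ a * (d i + r) ^ b * w i) -
      2 * ((∑ i, d i ^ a * w i) * ∑ i, (d i + r) ^ b * w i) := by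
    have h1 : (∑ i, w i) * ∑ i, d i ^ a * (d i + r) ^ b * w i =
        ∑ i, ∑ j, w j * (d i ^ a * (d i + r) ^ b * w i) := by
      rw [Finset.sum_mul_sum, Finset.sum_comm]
    have h1' : (∑ i, w i) * ∑ i, d i ^ a * (d i + r) ^ b * w i =
        ∑ i, ∑ j, w i * (d j ^ a * (d j + r) ^ b * w j) := by
      rw [Finset.sum_mul_sum]
    have h2 : (∑ i, d i ^ a * w i) * ∑ i, (d i + r) ^ b * w i =
        ∑ i, ∑ j, d i ^ a * w i * ((d j + r) ^ b * w j) := by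
      rw [Finset.sum_mul_sum]
    have h2' : (∑ i, d i ^ a * w i) * ∑ i, (d i + r) ^ b * w i =
        ∑ i, ∑ j, d j ^ a * w j * ((d i + r) ^ b * w i) := by
      rw [Finset.sum_mul_sum, Finset.sum_comm]
    rw [two_mul, two_mul]
    nth_rewrite 1 [h1]
    nth_rewrite 1 [h1']
    nth_rewrite 1 [h2]
    rw [h2']
    simp only [← Finset.sum_add_distrib, ← Finset.sum_sub_distrib]
    exact Finset.sum_congr rfl fun i _ => Finset.sum_congr rfl fun j _ => by ring
  rw [e] at key
  change (∑ i, d i ^ a * w i) * (∑ i, (d i + r) ^ b * w i) ≤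
    (∑ i, w i) * ∑ i, d i ^ a * (d i + r) ^ b * w i
  linarith

theorem quadForm_pow_nonneg {A : Matrix n n ℝ} (hA : A.PosSemidef) (a : ℕ) (x : n → ℝ) :
    0 ≤ x ⬝ᵥ (A ^ a) *ᵥ x := by
  simpa using (hA.pow a).dotProduct_mulVec_nonneg x

/-- A rank-one update `x xᵀ` acts on the powers, tested at `x`, no worse than `|x|²` does. -/
theorem quadForm_pow_add_vecMulVec_le {A : Matrix n n ℝ} (hA : A.PosSemidef) {r : ℝ}
    {x : n → ℝ} (hr : x ⬝ᵥ x ≤ r) (q a : ℕ) :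
    x ⬝ᵥ (A ^ a * (A + vecMulVec x x) ^ q) *ᵥ x ≤ x ⬝ᵥ (A ^ a * (A + r • 1) ^ q) *ᵥ x := by
  have hxx : 0 ≤ x ⬝ᵥ x := Finset.sum_nonneg fun i _ => mul_self_nonneg _
  have hr0 : 0 ≤ r := hxx.trans hr
  -- Peeling off the leftmost factor either raises `a` by one or splits the form at x xᵀ into a
  -- product of two forms. Chebyshev's inequality recombines that product at the cost of |x|² ≤ r.
  induction q generalizing a with
  | zero => simp
  | succ q ih =>
    have e1 : x ⬝ᵥ (A ^ a * (A + vecMulVec x x) ^ (q + 1)) *ᵥ x =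
        x ⬝ᵥ (A ^ (a + 1) * (A + vecMulVec x x) ^ q) *ᵥ x +
        (x ⬝ᵥ (A ^ a) *ᵥ x) * (x ⬝ᵥ ((A + vecMulVec x x) ^ q) *ᵥ x) := by
      rw [pow_succ' (A + vecMulVec x x), Matrix.add_mul, Matrix.mul_add, ← Matrix.mul_assoc,
        ← pow_succ, add_mulVec, dotProduct_add]
      congr 1
      rw [← mulVec_mulVec, ← mulVec_mulVec, vecMulVec_mulVec]
      simp [mulVec_smul, mul_comm]
    have e2 : x ⬝ᵥ (A ^ a * (A + r • 1) ^ (q + 1)) *ᵥ x =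
        x ⬝ᵥ (A ^ (a + 1) * (A + r • 1) ^ q) *ᵥ x +
        r * (x ⬝ᵥ (A ^ a * (A + r • 1) ^ q) *ᵥ x) := by
      rw [pow_succ' (A + r • 1), Matrix.add_mul, Matrix.mul_add, ← Matrix.mul_assoc,
        ← pow_succ, add_mulVec, dotProduct_add]
      simp [smul_mulVec]
    rw [e1, e2]
    refine add_le_add (ih (a + 1)) ?_
    have h0 := ih 0
    rw [pow_zero, Matrix.one_mul, Matrix.one_mul] at h0
    have hpos : 0 ≤ x ⬝ᵥ (A ^ a * (A + r • 1) ^ q) *ᵥ x := by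
      obtain ⟨U, d, hU, hU', hd, rfl⟩ := exists_orthogonal_diagonalization hA
      rw [conj_diagonal_add_smul_one hU', conj_diagonal_pow hU hU', conj_diagonal_pow hU hU',
        conj_diagonal_mul hU, conj_diagonal_quadForm]
      refine Finset.sum_nonneg fun i _ => mul_nonneg (mul_nonneg (pow_nonneg (hd i) _)
        (pow_nonneg (add_nonneg (hd i) hr0) _)) (sq_nonneg _)
    calc (x ⬝ᵥ (A ^ a) *ᵥ x) * (x ⬝ᵥ ((A + vecMulVec x x) ^ q) *ᵥ x)
        ≤ (x ⬝ᵥ (A ^ a) *ᵥ x) * (x ⬝ᵥ ((A + r • 1) ^ q) *ᵥ x) :=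
          mul_le_mul_of_nonneg_left h0 (quadForm_pow_nonneg hA a x)
      _ ≤ (x ⬝ᵥ x) * (x ⬝ᵥ (A ^ a * (A + r • 1) ^ q) *ᵥ x) :=
          quadForm_mul_quadForm_le hA hr0 a q x
      _ ≤ _ := mul_le_mul_of_nonneg_right hr hpos

theorem pow_le_trace_pow {A : Matrix n n ℝ} (hA : A.PosSemidef) {t : ℝ} (ht : 0 ≤ t) {z : n → ℝ}
    (hz0 : z ≠ 0) (hz : t * (z ⬝ᵥ z) ≤ z ⬝ᵥ A *ᵥ z) (p : ℕ) : t ^ p ≤ (A ^ p).trace := by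
  have hzz : 0 < z ⬝ᵥ z := (Finset.sum_nonneg fun i _ => mul_self_nonneg _).lt_of_ne
    fun h => hz0 (dotProduct_self_eq_zero.1 h.symm)
  obtain ⟨U, d, hU, hU', hd, rfl⟩ := exists_orthogonal_diagonalization hA
  rw [conj_diagonal_quadForm, orthogonal_dotProduct hU', Finset.mul_sum] at hz
  rw [orthogonal_dotProduct hU'] at hzz
  obtain ⟨i, hi⟩ : ∃ i, t ≤ d i := by
    by_contra! h
    obtain ⟨i, -, hi⟩ := Finset.exists_lt_of_sum_lt (s := Finset.univ) (f := fun _ : n => (0 : ℝ))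
      (g := fun i => (Uᵀ *ᵥ z) i ^ 2) (by simpa using hzz)
    exact absurd hz (not_le.2 (Finset.sum_lt_sum
      (fun j _ => mul_le_mul_of_nonneg_right (h j).le (sq_nonneg _))
      ⟨i, Finset.mem_univ i, mul_lt_mul_of_pos_right (h i) hi⟩))
  rw [conj_diagonal_pow hU hU', conj_diagonal_trace hU]
  exact (pow_le_pow_left₀ ht hi p).trans
    (Finset.single_le_sum (f := fun i => d i ^ p) (fun j _ => pow_nonneg (hd j) p)
      (Finset.mem_univ i))

/-- The positive semidefinite matrix `A` with its spectrum cut at height `κ`. -/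
theorem exists_spectral_truncation {A : Matrix n n ℝ} (hA : A.PosSemidef) {κ : ℝ} (hκ : 0 < κ) :
    ∃ B : Matrix n n ℝ, B.PosSemidef ∧ (A - B).PosSemidef ∧ (κ⁻¹ • A ^ 2 - (A - B)).PosSemidef ∧
      (A ^ 2 - B ^ 2).PosSemidef ∧ ∀ z, z ⬝ᵥ (B ^ 2) *ᵥ z ≤ κ ^ 2 * (z ⬝ᵥ z) := by
  obtain ⟨U, d, hU, hU', hd, rfl⟩ := exists_orthogonal_diagonalization hA
  have hpsd : ∀ e : n → ℝ, (∀ i, 0 ≤ e i) → (U * diagonal e * Uᵀ).PosSemidef := fun e he => by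
    simpa using (posSemidef_diagonal_iff.2 he).mul_mul_conjTranspose_same U
  have hsub : ∀ e f : n → ℝ, U * diagonal e * Uᵀ - U * diagonal f * Uᵀ =
      U * diagonal (fun i => e i - f i) * Uᵀ := fun e f => by
    rw [← Matrix.sub_mul, ← Matrix.mul_sub, diagonal_sub]
  have hsmul : ∀ e : n → ℝ, κ⁻¹ • (U * diagonal e * Uᵀ) =
      U * diagonal (fun i => κ⁻¹ * e i) * Uᵀ := fun e => by
    rw [← Matrix.smul_mul, ← Matrix.mul_smul, ← diagonal_smul]; rfl
  -- Everything reduces to scalar facts about min(d, κ). The useful one is d - min(d, κ) ≤ d²/κ,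
  -- which bounds the loss by the squared matrix.
  refine ⟨U * diagonal (fun i => min (d i) κ) * Uᵀ, hpsd _ fun i => le_min (hd i) hκ.le, ?_, ?_,
    ?_, fun z => ?_⟩
  · rw [hsub]
    exact hpsd _ fun i => sub_nonneg.2 (min_le_left _ _)
  · rw [hsub, conj_diagonal_pow hU hU', hsmul, hsub]
    refine hpsd _ fun i => ?_
    rcases le_total (d i) κ with h | h
    · rw [min_eq_left h]
      have : 0 ≤ κ⁻¹ * d i ^ 2 := by positivity
      linarith
    · rw [min_eq_right h]
      have : κ⁻¹ * d i ^ 2 - (d i - κ) = κ⁻¹ * (d i ^ 2 - d i * κ + κ ^ 2) := by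
        field_simp
        ring
      rw [this]
      refine mul_nonneg (inv_nonneg.2 hκ.le) ?_
      nlinarith [mul_nonneg (hd i) (sub_nonneg.2 h), sq_nonneg κ]
  · rw [conj_diagonal_pow hU hU', conj_diagonal_pow hU hU', hsub]
    exact hpsd _ fun i =>
      sub_nonneg.2 (pow_le_pow_left₀ (le_min (hd i) hκ.le) (min_le_left _ _) 2)
  · rw [conj_diagonal_pow hU hU', conj_diagonal_quadForm, orthogonal_dotProduct hU',
      Finset.mul_sum]
    exact Finset.sum_le_sum fun i _ => mul_le_mul_of_nonneg_right
      (pow_le_pow_left₀ (le_min (hd i) hκ.le) (min_le_right _ _) 2) (sq_nonneg _)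

end Spectral

/-! ### Trace moments of the Gram matrix of a random subfamily. -/

section Sampling

open Matrix

variable {n ι : Type*} [Fintype n] [DecidableEq n] [DecidableEq ι]

/-- The matrix `∑ i ∈ I, x i (x i)ᵀ`. -/
def sampleGram {n ι : Type*} (x : ι → n → ℝ) (I : Finset ι) : Matrix n n ℝ :=
  ∑ i ∈ I, vecMulVec (x i) (x i)

theorem sampleGram_posSemidef {n ι : Type*} [Fintype n] (x : ι → n → ℝ) (I : Finset ι) :
    (sampleGram x I).PosSemidef :=
  posSemidef_sum I fun i _ => by simpa using posSemidef_vecMulVec_self_star (x i)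

theorem sampleGram_quadForm {n ι : Type*} [Fintype n] (x : ι → n → ℝ) (I : Finset ι)
    (z : n → ℝ) : z ⬝ᵥ sampleGram x I *ᵥ z = ∑ i ∈ I, (x i ⬝ᵥ z) ^ 2 := by
  simp only [sampleGram, sum_mulVec, dotProduct_sum, vecMulVec_mulVec]
  refine Finset.sum_congr rfl fun i _ => ?_
  simp [dotProduct_comm z, sq]

theorem trace_mul_vecMulVec {n : Type*} [Fintype n] (Q : Matrix n n ℝ) (x : n → ℝ) :
    (Q * vecMulVec x x).trace = x ⬝ᵥ Q *ᵥ x := by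
  rw [mul_vecMulVec, trace_vecMulVec, dotProduct_comm]

/-- In an orthonormal eigenbasis of `Q`, the frame bound `hb` is applied to each eigenvector and
weighted by its eigenvalue. -/
theorem sum_quadForm_le_mul_trace {n ι : Type*} [Fintype n] [DecidableEq n] {x : ι → n → ℝ} {U : Finset ι} {b : ℝ}
    (hb : ∀ z, ∑ i ∈ U, (x i ⬝ᵥ z) ^ 2 ≤ b * (z ⬝ᵥ z)) {Q : Matrix n n ℝ} (hQ : Q.PosSemidef) :
    ∑ i ∈ U, x i ⬝ᵥ Q *ᵥ x i ≤ b * Q.trace := by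
  obtain ⟨V, d, hV, hV', hd, rfl⟩ := exists_orthogonal_diagonalization hQ
  simp only [conj_diagonal_quadForm]
  rw [conj_diagonal_trace hV, Finset.sum_comm, Finset.mul_sum]
  refine Finset.sum_le_sum fun l _ => ?_
  rw [← Finset.mul_sum, mul_comm b]
  refine mul_le_mul_of_nonneg_left ?_ (hd l)
  have h1 : ∀ i, (Vᵀ *ᵥ x i) l = x i ⬝ᵥ V.col l := fun i => by
    rw [dotProduct_comm]; rfl
  have h2 : V.col l ⬝ᵥ V.col l = 1 := by
    have := congrFun (congrFun hV l) l
    simpa [mul_apply, dotProduct] using this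
  have := hb (V.col l)
  rw [h2, mul_one] at this
  simpa only [h1] using this

/-- Double counting through (I, i) ↔ (I \ {i}, i). After the exchange the removed index ranges
freely outside the smaller set. -/
theorem sum_powersetCard_succ_erase (U : Finset ι) (k : ℕ) (f : ι → Finset ι → ℝ) :
    ∑ I ∈ U.powersetCard (k + 1), ∑ i ∈ I, f i (I.erase i) =
      ∑ J ∈ U.powersetCard k, ∑ i ∈ U \ J, f i J := by
  rw [Finset.sum_sigma', Finset.sum_sigma']
  refine Finset.sum_bij' (fun q _ => ⟨q.1.erase q.2, q.2⟩) (fun q _ => ⟨insert q.2 q.1, q.2⟩)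
    ?_ ?_ ?_ ?_ ?_
  · rintro ⟨I, i⟩ h
    simp only [Finset.mem_sigma, Finset.mem_powersetCard, Finset.mem_sdiff] at h ⊢
    obtain ⟨⟨h1, h2⟩, h3⟩ := h
    refine ⟨⟨(Finset.erase_subset _ _).trans h1, ?_⟩, h1 h3, Finset.notMem_erase _ _⟩
    rw [Finset.card_erase_of_mem h3, h2]; rfl
  · rintro ⟨I, i⟩ h
    simp only [Finset.mem_sigma, Finset.mem_powersetCard, Finset.mem_sdiff] at h ⊢
    obtain ⟨⟨h1, h2⟩, h3, h4⟩ := h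
    refine ⟨⟨Finset.insert_subset h3 h1, ?_⟩, Finset.mem_insert_self _ _⟩
    rw [Finset.card_insert_of_notMem h4, h2]
  · rintro ⟨I, i⟩ h
    simp only [Finset.mem_sigma] at h
    simp [Finset.insert_erase h.2]
  · rintro ⟨I, i⟩ h
    simp only [Finset.mem_sigma, Finset.mem_sdiff] at h
    simp [Finset.erase_insert h.2.2]
  · rintro ⟨I, i⟩ h
    rfl

/-- One step of the recursion: split one factor into rank-one terms, replace x_i x_iᵀ in the others
by r · 1, exchange the sums, then let i run over all of `U` so that the frame bound turns the forms
into a trace. -/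
theorem sum_trace_sampleGram_pow_succ_le {x : ι → n → ℝ} {U : Finset ι} {b r : ℝ} (hr0 : 0 ≤ r)
    (hr : ∀ i ∈ U, x i ⬝ᵥ x i ≤ r) (hb : ∀ z, ∑ i ∈ U, (x i ⬝ᵥ z) ^ 2 ≤ b * (z ⬝ᵥ z)) (k p : ℕ) :
    ∑ I ∈ U.powersetCard (k + 1), (sampleGram x I ^ (p + 1)).trace ≤
      b * ∑ J ∈ U.powersetCard k, ((sampleGram x J + r • 1) ^ p).trace := by
  have hQ : ∀ J, ((sampleGram x J + r • (1 : Matrix n n ℝ)) ^ p).PosSemidef := fun J =>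
    ((sampleGram_posSemidef x J).add (PosSemidef.one.smul hr0)).pow p
  calc ∑ I ∈ U.powersetCard (k + 1), (sampleGram x I ^ (p + 1)).trace
      ≤ ∑ I ∈ U.powersetCard (k + 1), ∑ i ∈ I,
          x i ⬝ᵥ ((sampleGram x (I.erase i) + r • 1) ^ p) *ᵥ x i := by
        refine Finset.sum_le_sum fun I hI => ?_
        rw [pow_succ]
        nth_rewrite 2 [sampleGram]
        rw [Matrix.mul_sum, trace_sum]
        refine Finset.sum_le_sum fun i hi => ?_
        rw [trace_mul_vecMulVec]
        have e : sampleGram x I = sampleGram x (I.erase i) + vecMulVec (x i) (x i) :=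
          (Finset.sum_erase_add _ _ hi).symm
        have := quadForm_pow_add_vecMulVec_le (sampleGram_posSemidef x (I.erase i))
          (hr i ((Finset.mem_powersetCard.1 hI).1 hi)) p 0
        rwa [pow_zero, Matrix.one_mul, Matrix.one_mul, ← e] at this
    _ = ∑ J ∈ U.powersetCard k, ∑ i ∈ U \ J, x i ⬝ᵥ ((sampleGram x J + r • 1) ^ p) *ᵥ x i :=
        sum_powersetCard_succ_erase U k
          fun i J => x i ⬝ᵥ ((sampleGram x J + r • 1) ^ p) *ᵥ x i
    _ ≤ ∑ J ∈ U.powersetCard k, b * ((sampleGram x J + r • 1) ^ p).trace := by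
        refine Finset.sum_le_sum fun J _ => le_trans ?_ (sum_quadForm_le_mul_trace hb (hQ J))
        refine Finset.sum_le_sum_of_subset_of_nonneg Finset.sdiff_subset fun i _ _ => ?_
        simpa using (hQ J).dotProduct_mulVec_nonneg (x i)
    _ = _ := by rw [Finset.mul_sum]

theorem trace_add_smul_one_pow (S : Matrix n n ℝ) (r : ℝ) (p : ℕ) :
    ((S + r • 1) ^ p).trace = ∑ j ∈ Finset.range (p + 1), (S ^ j).trace * r ^ (p - j) * p.choose j := by
  have : Commute S (r • (1 : Matrix n n ℝ)) := (Commute.one_right S).smul_right r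
  rw [this.add_pow, trace_sum]
  refine Finset.sum_congr rfl fun j _ => ?_
  rw [smul_pow, one_pow, Matrix.mul_smul, Matrix.mul_one, Matrix.smul_mul, trace_smul,
    ← nsmul_eq_mul', trace_smul]
  simp only [smul_eq_mul, nsmul_eq_mul]
  ring

/-- Moments of the Gram matrix of a uniformly random `k`-subset of a family of vectors. -/
theorem sum_trace_sampleGram_pow_le {x : ι → n → ℝ} {U : Finset ι} {b r m₀ T : ℝ} {k₀ P : ℕ}
    (hr0 : 0 ≤ r) (hr : ∀ i ∈ U, x i ⬝ᵥ x i ≤ r) (hb0 : 0 ≤ b)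
    (hb : ∀ z, ∑ i ∈ U, (x i ⬝ᵥ z) ^ 2 ≤ b * (z ⬝ᵥ z)) (hT : 0 < T)
    (hk₀ : k₀ ≤ U.card) (hm₀ : b * k₀ ≤ m₀ * ((U.card : ℝ) + 1 - k₀))
    (hmT : m₀ * Real.exp (P * r / T) ≤ T) (p : ℕ) (hp : p ≤ P) (k : ℕ) (hk : k ≤ k₀) :
    ∑ I ∈ U.powersetCard k, (sampleGram x I ^ p).trace ≤
      (U.card.choose k : ℝ) * (Fintype.card n * T ^ p) := by
  -- Strong induction, because expanding (S + r)^p involves every lower moment.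
  induction p using Nat.strong_induction_on generalizing k with
  | _ p ih =>
  rcases p with _ | p
  · simp [Finset.card_powersetCard]
  rcases k with _ | k
  · have : sampleGram x ∅ = 0 := by simp [sampleGram]
    simp only [Finset.powersetCard_zero, Finset.sum_singleton, this]
    rw [zero_pow (Nat.succ_ne_zero p), trace_zero]
    positivity
  have hkU : (k : ℝ) + 1 ≤ U.card := by exact_mod_cast hk.trans hk₀
  have hkk : (k : ℝ) + 1 ≤ k₀ := by exact_mod_cast hk
  have hk₀U : (k₀ : ℝ) ≤ U.card := by exact_mod_cast hk₀
  have hm₀0 : 0 ≤ m₀ := by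
    have h1 : 0 ≤ m₀ * ((U.card : ℝ) + 1 - k₀) := le_trans (by positivity) hm₀
    exact nonneg_of_mul_nonneg_left h1 (by linarith)
  have hbm : b * (k + 1) ≤ m₀ * ((U.card : ℝ) - k) :=
    calc b * ((k : ℝ) + 1) ≤ b * k₀ := mul_le_mul_of_nonneg_left hkk hb0
      _ ≤ _ := hm₀
      _ ≤ _ := mul_le_mul_of_nonneg_left (by linarith) hm₀0
  have hchoose : (U.card.choose (k + 1) : ℝ) * (k + 1) = U.card.choose k * ((U.card : ℝ) - k) := by
    have := Nat.choose_succ_right_eq U.card k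
    have h2 : ((U.card - k : ℕ) : ℝ) = (U.card : ℝ) - k := by
      rw [Nat.cast_sub (by omega)]
    rw [← h2]
    exact_mod_cast this
  -- The shifts by r cost (1 + r/T)^p ≤ exp(P r / T) in total, which is the room left between `m₀`
  -- and `T`.
  have hpow : m₀ * (T + r) ^ p ≤ T ^ (p + 1) := by
    have h1 : (T + r) ^ p ≤ T ^ p * Real.exp (P * r / T) := by
      have e : T + r = T * (r / T + 1) := by field_simp; ring
      rw [e, mul_pow]
      refine mul_le_mul_of_nonneg_left ?_ (by positivity)
      calc (r / T + 1) ^ p ≤ Real.exp (r / T) ^ p :=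
            pow_le_pow_left₀ (by positivity) (Real.add_one_le_exp _) p
        _ = Real.exp (p * (r / T)) := (Real.exp_nat_mul _ _).symm
        _ ≤ _ := by
            rw [mul_div_assoc]
            refine Real.exp_le_exp.2 (mul_le_mul_of_nonneg_right ?_ (by positivity))
            exact_mod_cast (Nat.le_succ p).trans hp
    calc m₀ * (T + r) ^ p ≤ m₀ * (T ^ p * Real.exp (P * r / T)) :=
          mul_le_mul_of_nonneg_left h1 hm₀0
      _ = T ^ p * (m₀ * Real.exp (P * r / T)) := by ring
      _ ≤ T ^ p * T := mul_le_mul_of_nonneg_left hmT (by positivity)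
      _ = _ := (pow_succ T p).symm
  -- The bounds T^j on the lower moments resum by the binomial theorem to (T + r)^p.
  have hsum : ∑ J ∈ U.powersetCard k, ((sampleGram x J + r • 1) ^ p).trace ≤
      (U.card.choose k : ℝ) * (Fintype.card n * (T + r) ^ p) := by
    simp only [trace_add_smul_one_pow]
    rw [Finset.sum_comm, add_pow, Finset.mul_sum, Finset.mul_sum]
    refine Finset.sum_le_sum fun j hj => ?_
    have hj' : j ≤ p := Nat.lt_succ_iff.1 (Finset.mem_range.1 hj)
    rw [← Finset.sum_mul, ← Finset.sum_mul]
    have := ih j (by omega) (by omega) k (by omega)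
    calc _ ≤ (U.card.choose k : ℝ) * (Fintype.card n * T ^ j) * r ^ (p - j) * p.choose j := by
          gcongr
      _ = _ := by ring
  refine (sum_trace_sampleGram_pow_succ_le hr0 hr hb k p).trans ?_
  refine (mul_le_mul_of_nonneg_left hsum hb0).trans ?_
  have hk1 : (0 : ℝ) < k + 1 := by positivity
  refine le_of_mul_le_mul_right ?_ hk1
  calc b * ((U.card.choose k : ℝ) * (Fintype.card n * (T + r) ^ p)) * (k + 1)
      = (b * (k + 1)) * ((U.card.choose k : ℝ) * (Fintype.card n * (T + r) ^ p)) := by ring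
    _ ≤ (m₀ * ((U.card : ℝ) - k)) * ((U.card.choose k : ℝ) * (Fintype.card n * (T + r) ^ p)) :=
        mul_le_mul_of_nonneg_right hbm (by positivity)
    _ = (U.card.choose k * ((U.card : ℝ) - k)) * Fintype.card n * (m₀ * (T + r) ^ p) := by ring
    _ = (U.card.choose (k + 1) : ℝ) * (k + 1) * Fintype.card n * (m₀ * (T + r) ^ p) := by
        rw [hchoose]
    _ ≤ (U.card.choose (k + 1) : ℝ) * (k + 1) * Fintype.card n * T ^ (p + 1) := by
        gcongr
    _ = _ := by ring

open Classical in
/-- Tail bound for the largest eigenvalue of the Gram matrix of a random subfamily. -/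
theorem card_exceeding_sampleGram_mul_pow_le {x : ι → n → ℝ} {U : Finset ι} {b r m₀ T t : ℝ}
    {k P : ℕ} (hr0 : 0 ≤ r) (hr : ∀ i ∈ U, x i ⬝ᵥ x i ≤ r) (hb0 : 0 ≤ b)
    (hb : ∀ z, ∑ i ∈ U, (x i ⬝ᵥ z) ^ 2 ≤ b * (z ⬝ᵥ z)) (hT : 0 < T) (ht : 0 ≤ t)
    (hk : k ≤ U.card) (hm₀ : b * k ≤ m₀ * ((U.card : ℝ) + 1 - k))
    (hmT : m₀ * Real.exp (P * r / T) ≤ T) :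
    (((U.powersetCard k).filter fun I => ∃ z, t * (z ⬝ᵥ z) < ∑ i ∈ I, (x i ⬝ᵥ z) ^ 2).card : ℝ) *
      t ^ P ≤ (U.card.choose k : ℝ) * (Fintype.card n * T ^ P) := by
  refine le_trans ?_ (sum_trace_sampleGram_pow_le hr0 hr hb0 hb hT hk hm₀ hmT P le_rfl k le_rfl)
  rw [← nsmul_eq_mul]
  refine (Finset.card_nsmul_le_sum _ (fun I => (sampleGram x I ^ P).trace) _ ?_).trans
    (Finset.sum_le_sum_of_subset_of_nonneg (Finset.filter_subset _ _) fun I _ _ =>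
      ((sampleGram_posSemidef x I).pow P).trace_nonneg)
  intro I hI
  obtain ⟨z, hz⟩ := (Finset.mem_filter.1 hI).2
  rw [← sampleGram_quadForm] at hz
  refine pow_le_trace_pow (sampleGram_posSemidef x I) ht ?_ hz.le P
  rintro rfl
  simp at hz

end Sampling

/-! ### Decoupling of hollow quadratic forms over random index sets. -/

section Decoupling

open Matrix

variable {ι : Type*} [Fintype ι] [DecidableEq ι]

/-- Row `i` of `Y` with the entries outside `B` set to zero. -/
def rowOn {ι : Type*} [DecidableEq ι] (Y : Matrix ι ι ℝ) (B : Finset ι) (i : ι) : ι → ℝ :=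
  fun j => if j ∈ B then Y i j else 0

theorem rowOn_dotProduct (Y : Matrix ι ι ℝ) (B : Finset ι) (i : ι) (z : ι → ℝ) :
    rowOn Y B i ⬝ᵥ z = ∑ j ∈ B, Y i j * z j := by
  simp [rowOn, dotProduct, ite_mul, Finset.sum_ite_mem]

/-- Two memberships are prescribed and the others are free. The resulting proportion 1/4 is the
source of the factor 4 in the decoupling identity. -/
theorem card_separating_subsets {ι : Type*} [DecidableEq ι] {I : Finset ι} {i j : ι} (hi : i ∈ I)
    (hj : j ∈ I) (hij : i ≠ j) :
    4 * (I.powerset.filter fun B => i ∉ B ∧ j ∈ B).card = 2 ^ I.card := by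
  have e : (I.powerset.filter fun B => i ∉ B ∧ j ∈ B) =
      ((I.erase i).erase j).powerset.image (insert j) := by
    ext B
    simp only [Finset.mem_filter, Finset.mem_powerset, Finset.mem_image]
    constructor
    · rintro ⟨h1, h2, h3⟩
      refine ⟨B.erase j, ?_, Finset.insert_erase h3⟩
      refine Finset.erase_subset_erase _ fun a ha => Finset.mem_erase.2 ⟨?_, h1 ha⟩
      rintro rfl
      exact h2 ha
    · rintro ⟨C, hC, rfl⟩
      refine ⟨Finset.insert_subset hj (hC.trans ((Finset.erase_subset _ _).trans
        (Finset.erase_subset _ _))), ?_, Finset.mem_insert_self _ _⟩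
      rw [Finset.mem_insert, not_or]
      refine ⟨hij, fun h => ?_⟩
      simpa using hC h
  rw [e, Finset.card_image_of_injOn, Finset.card_powerset,
    Finset.card_erase_of_mem (Finset.mem_erase.2 ⟨hij.symm, hj⟩), Finset.card_erase_of_mem hi]
  · have : 2 ≤ I.card := Finset.one_lt_card.2 ⟨i, hi, j, hj, hij⟩
    obtain ⟨c, hc⟩ := Nat.exists_eq_add_of_le this
    rw [hc]
    have : 2 + c - 1 - 1 = c := by omega
    rw [this, pow_add]; norm_num
  · intro C hC D hD h
    have hC' : j ∉ C := fun h => by simpa using (Finset.mem_powerset.1 hC) h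
    have hD' : j ∉ D := fun h => by simpa using (Finset.mem_powerset.1 hD) h
    rw [← Finset.erase_insert hC', ← Finset.erase_insert hD']
    exact congrArg (fun s => Finset.erase s j) h

/-- A hollow quadratic form is four times the average of its bipartite restrictions. -/
theorem quadForm_eq_sum_bipartite {Y : Matrix ι ι ℝ} (hY : ∀ i, Y i i = 0) {I : Finset ι}
    {z : ι → ℝ} (hz : ∀ j ∉ I, z j = 0) :
    2 ^ I.card * (z ⬝ᵥ Y *ᵥ z) =
      4 * ∑ B ∈ I.powerset, ∑ i ∈ I \ B, z i * (rowOn Y B i ⬝ᵥ z) := by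
  have h1 : z ⬝ᵥ Y *ᵥ z = ∑ i ∈ I, ∑ j ∈ I, z i * (Y i j * z j) := by
    simp only [dotProduct, mulVec, Finset.mul_sum]
    rw [← Finset.sum_subset (Finset.subset_univ I)]
    · refine Finset.sum_congr rfl fun i _ => ?_
      rw [← Finset.sum_subset (Finset.subset_univ I)]
      intro j _ hj
      simp [hz j hj]
    · intro i _ hi
      simp [hz i hi]
  have h2 : ∀ B ∈ I.powerset, ∑ i ∈ I \ B, z i * (rowOn Y B i ⬝ᵥ z) =
      ∑ i ∈ I, ∑ j ∈ I, if i ∉ B ∧ j ∈ B then z i * (Y i j * z j) else 0 := by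
    intro B hB
    have hB' := Finset.mem_powerset.1 hB
    rw [Finset.sdiff_eq_filter, Finset.sum_filter]
    refine Finset.sum_congr rfl fun i _ => ?_
    by_cases hi : i ∈ B
    · simp [hi]
    · simp only [hi, not_false_eq_true, if_true, true_and]
      rw [rowOn_dotProduct, Finset.mul_sum, ← Finset.sum_filter, Finset.filter_mem_eq_inter,
        Finset.inter_eq_right.2 hB']
  rw [Finset.sum_congr rfl h2, Finset.sum_comm, h1, Finset.mul_sum, Finset.mul_sum]
  refine Finset.sum_congr rfl fun i hi => ?_
  rw [Finset.sum_comm, Finset.mul_sum, Finset.mul_sum]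
  refine Finset.sum_congr rfl fun j hj => ?_
  rw [← Finset.sum_filter, Finset.sum_const, nsmul_eq_mul]
  by_cases hij : i = j
  · subst hij; simp [hY]
  · have := card_separating_subsets hi hj hij
    have h' : (4 : ℝ) * ((I.powerset.filter fun B => i ∉ B ∧ j ∈ B).card : ℝ) = 2 ^ I.card := by
      exact_mod_cast this
    rw [← h']; ring

/-- By Cauchy–Schwarz each bipartite piece is at most √q(B) |z|², where q(B) is a Rayleigh quotient
of the Gram matrix of rows. Jensen's inequality at exponent 2P passes from the average of √q(B) to
traces that no longer depend on `z`; 16^P is 4^{2P}. -/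
theorem pow_mul_two_pow_le_sum_trace {Y : Matrix ι ι ℝ} (hY : ∀ i, Y i i = 0) {I : Finset ι}
    {z : ι → ℝ} (hz : ∀ j ∉ I, z j = 0) {s : ℝ} (hs : 0 ≤ s)
    (hsz : s * (z ⬝ᵥ z) < |z ⬝ᵥ Y *ᵥ z|) {P : ℕ} (hP : 0 < P) :
    s ^ (2 * P) * 2 ^ I.card ≤
      16 ^ P * ∑ B ∈ I.powerset, (sampleGram (rowOn Y B) (I \ B) ^ P).trace := by
  have hz0 : z ≠ 0 := by
    rintro rfl
    simp at hsz
  have hzz : 0 < z ⬝ᵥ z := (Finset.sum_nonneg fun i _ => mul_self_nonneg _).lt_of_ne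
    fun h => hz0 (dotProduct_self_eq_zero.1 h.symm)
  set q : Finset ι → ℝ := fun B => (∑ i ∈ I \ B, (rowOn Y B i ⬝ᵥ z) ^ 2) / (z ⬝ᵥ z) with hq
  have hq0 : ∀ B, 0 ≤ q B := fun B => div_nonneg (Finset.sum_nonneg fun _ _ => sq_nonneg _) hzz.le
  have hqB : ∀ B, q B ^ P ≤ (sampleGram (rowOn Y B) (I \ B) ^ P).trace := fun B => by
    refine pow_le_trace_pow (sampleGram_posSemidef _ _) (hq0 B) hz0 ?_ P
    rw [sampleGram_quadForm, hq]
    simp only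
    rw [div_mul_cancel₀ _ hzz.ne']
  have hbip : ∀ B, |∑ i ∈ I \ B, z i * (rowOn Y B i ⬝ᵥ z)| ≤ √(q B) * (z ⬝ᵥ z) := fun B => by
    refine Real.abs_le_sqrt (y := q B * (z ⬝ᵥ z) ^ 2) ?_ |>.trans ?_
    · refine (Finset.sum_mul_sq_le_sq_mul_sq _ _ _).trans ?_
      have e : q B * (z ⬝ᵥ z) ^ 2 = (z ⬝ᵥ z) * ∑ i ∈ I \ B, (rowOn Y B i ⬝ᵥ z) ^ 2 := by
        simp only [hq]; field_simp
      rw [e]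
      refine mul_le_mul_of_nonneg_right ?_ (Finset.sum_nonneg fun _ _ => sq_nonneg _)
      have : z ⬝ᵥ z = ∑ i, z i ^ 2 := Finset.sum_congr rfl fun i _ => (sq _).symm
      rw [this]
      exact Finset.sum_le_sum_of_subset_of_nonneg (Finset.subset_univ _) fun _ _ _ => sq_nonneg _
    · rw [Real.sqrt_mul (hq0 B), Real.sqrt_sq hzz.le]
  have h1 : 2 ^ I.card * s ≤ 4 * ∑ B ∈ I.powerset, √(q B) := by
    refine le_of_mul_le_mul_right ?_ hzz
    calc 2 ^ I.card * s * (z ⬝ᵥ z) ≤ 2 ^ I.card * |z ⬝ᵥ Y *ᵥ z| := by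
          rw [mul_assoc]; exact mul_le_mul_of_nonneg_left hsz.le (by positivity)
      _ = |2 ^ I.card * (z ⬝ᵥ Y *ᵥ z)| := by
          rw [abs_mul, abs_of_nonneg (by positivity : (0 : ℝ) ≤ 2 ^ I.card)]
      _ = 4 * |∑ B ∈ I.powerset, ∑ i ∈ I \ B, z i * (rowOn Y B i ⬝ᵥ z)| := by
          rw [quadForm_eq_sum_bipartite hY hz, abs_mul]; norm_num
      _ ≤ 4 * ∑ B ∈ I.powerset, √(q B) * (z ⬝ᵥ z) := by
          gcongr
          exact (Finset.abs_sum_le_sum_abs _ _).trans (Finset.sum_le_sum fun B _ => hbip B)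
      _ = _ := by rw [← Finset.sum_mul, mul_assoc]
  obtain ⟨M, hM⟩ : ∃ M, 2 * P = M + 1 := ⟨2 * P - 1, by omega⟩
  have hJ : (∑ B ∈ I.powerset, √(q B)) ^ (2 * P) ≤
      (2 ^ I.card) ^ M * ∑ B ∈ I.powerset, q B ^ P := by
    have h := pow_sum_le_card_mul_sum_pow (s := I.powerset) (f := fun B => √(q B))
      (fun B _ => Real.sqrt_nonneg _) M
    rw [← hM, Finset.card_powerset] at h
    simpa only [pow_mul, Real.sq_sqrt (hq0 _), Nat.cast_pow, Nat.cast_ofNat] using h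
  have hc : (0 : ℝ) < (2 ^ I.card) ^ M := by positivity
  refine le_of_mul_le_mul_left ?_ hc
  calc (2 ^ I.card) ^ M * (s ^ (2 * P) * 2 ^ I.card) = (2 ^ I.card * s) ^ (2 * P) := by
        rw [mul_pow, hM, pow_succ (2 ^ I.card : ℝ)]; ring
    _ ≤ (4 * ∑ B ∈ I.powerset, √(q B)) ^ (2 * P) := pow_le_pow_left₀ (by positivity) h1 _
    _ = 16 ^ P * (∑ B ∈ I.powerset, √(q B)) ^ (2 * P) := by
        rw [mul_pow, pow_mul]; norm_num
    _ ≤ 16 ^ P * ((2 ^ I.card) ^ M * ∑ B ∈ I.powerset, q B ^ P) := by gcongr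
    _ ≤ 16 ^ P * ((2 ^ I.card) ^ M *
          ∑ B ∈ I.powerset, (sampleGram (rowOn Y B) (I \ B) ^ P).trace) := by
        gcongr with B _
        exact hqB B
    _ = _ := by ring

/-- Once `B` is fixed, the rest of a uniform k-set containing it is a uniform subset of the
complement, as the moment bound requires. -/
theorem sum_supersets_eq_sum_powersetCard_compl {B : Finset ι} {k : ℕ} (f : Finset ι → ℝ)
    (hB : B.card ≤ k) :
    ∑ I ∈ ((Finset.univ : Finset ι).powersetCard k).filter (B ⊆ ·), f (I \ B) =
      ∑ A ∈ Bᶜ.powersetCard (k - B.card), f A := by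
  refine Finset.sum_bij' (fun I _ => I \ B) (fun A _ => A ∪ B) ?_ ?_ ?_ ?_ ?_
  · intro I hI
    simp only [Finset.mem_filter, Finset.mem_powersetCard] at hI ⊢
    refine ⟨fun a ha => by simpa using (Finset.mem_sdiff.1 ha).2, ?_⟩
    rw [Finset.card_sdiff_of_subset hI.2, hI.1.2]
  · intro A hA
    simp only [Finset.mem_filter, Finset.mem_powersetCard] at hA ⊢
    refine ⟨⟨Finset.subset_univ _, ?_⟩, Finset.subset_union_right⟩
    rw [Finset.card_union_of_disjoint (Finset.subset_compl_iff_disjoint_right.1 hA.1), hA.2]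
    omega
  · intro I hI
    exact Finset.sdiff_union_of_subset (Finset.mem_filter.1 hI).2
  · intro A hA
    exact Finset.union_sdiff_cancel_right
      (Finset.subset_compl_iff_disjoint_right.1 (Finset.mem_powersetCard.1 hA).1)
  · intro I _
    rfl

/-- The index sets `I` on which all rows of `Y` are short, and whose columns form a matrix of
squared norm at most `b`. -/
def Regular {ι : Type*} [Fintype ι] (Y : Matrix ι ι ℝ) (r b : ℝ) (I : Finset ι) : Prop :=
  (∀ i, ∑ j ∈ I, Y i j ^ 2 ≤ r) ∧
    ∀ z : ι → ℝ, (∀ j ∉ I, z j = 0) → (Y *ᵥ z) ⬝ᵥ (Y *ᵥ z) ≤ b * (z ⬝ᵥ z)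

theorem Regular.mono {ι : Type*} [Fintype ι] {Y : Matrix ι ι ℝ} {r b : ℝ} {I B : Finset ι}
    (h : Regular Y r b I) (hB : B ⊆ I) : Regular Y r b B :=
  ⟨fun i => (Finset.sum_le_sum_of_subset_of_nonneg hB fun _ _ _ => sq_nonneg _).trans (h.1 i),
    fun z hz => h.2 z fun j hj => hz j fun hjB => hj (hB hjB)⟩

theorem Regular.sum_trace_le {Y : Matrix ι ι ℝ} {r b m₀ T : ℝ} {k P : ℕ} {B : Finset ι}
    (hB : Regular Y r b B) (hr0 : 0 ≤ r) (hb0 : 0 ≤ b) (hT : 0 < T)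
    (hk : k ≤ Fintype.card ι) (hBk : B.card ≤ k)
    (hm₀ : b * k ≤ m₀ * ((Fintype.card ι : ℝ) + 1 - k)) (hmT : m₀ * Real.exp (P * r / T) ≤ T) :
    ∑ I ∈ ((Finset.univ : Finset ι).powersetCard k).filter (B ⊆ ·),
        (sampleGram (rowOn Y B) (I \ B) ^ P).trace ≤
      ((((Finset.univ : Finset ι).powersetCard k).filter (B ⊆ ·)).card : ℝ) *
        (Fintype.card ι * T ^ P) := by
  have hcard : ((((Finset.univ : Finset ι).powersetCard k).filter (B ⊆ ·)).card : ℝ) =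
      (Bᶜ.card.choose (k - B.card) : ℝ) := by
    have := sum_supersets_eq_sum_powersetCard_compl (ι := ι) (fun _ => 1) hBk
    simpa [Finset.card_powersetCard] using this
  rw [hcard, sum_supersets_eq_sum_powersetCard_compl
    (fun A => (sampleGram (rowOn Y B) A ^ P).trace) hBk]
  have hBN : B.card ≤ Fintype.card ι := hBk.trans hk
  refine sum_trace_sampleGram_pow_le (b := b) (r := r) (m₀ := m₀) (k₀ := k - B.card) hr0 ?_ hb0 ?_
    hT ?_ ?_ hmT P le_rfl _ le_rfl
  · intro i _
    rw [rowOn_dotProduct]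
    refine le_trans (le_of_eq (Finset.sum_congr rfl fun j hj => ?_)) (hB.1 i)
    simp [rowOn, hj, sq]
  · intro z
    set w : ι → ℝ := fun j => if j ∈ B then z j else 0 with hw
    have h1 : ∀ i, rowOn Y B i ⬝ᵥ z = (Y *ᵥ w) i := fun i => by
      rw [rowOn_dotProduct]
      simp [hw, mulVec, dotProduct, Finset.sum_ite_mem]
    calc ∑ i ∈ Bᶜ, (rowOn Y B i ⬝ᵥ z) ^ 2 ≤ ∑ i, (rowOn Y B i ⬝ᵥ z) ^ 2 :=
          Finset.sum_le_sum_of_subset_of_nonneg (Finset.subset_univ _) fun _ _ _ => sq_nonneg _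
      _ = (Y *ᵥ w) ⬝ᵥ (Y *ᵥ w) := Finset.sum_congr rfl fun i _ => by rw [h1, sq]
      _ ≤ b * (w ⬝ᵥ w) := hB.2 w fun j hj => by simp [hw, hj]
      _ ≤ b * (z ⬝ᵥ z) := by
          refine mul_le_mul_of_nonneg_left (Finset.sum_le_sum fun j _ => ?_) hb0
          by_cases hj : j ∈ B
          · simp [hw, hj]
          · simp [hw, hj, mul_self_nonneg]
  · rw [Finset.card_compl]; omega
  -- The size of `B` cancels: (N - |B|) + 1 - (k - |B|) = N + 1 - k, so one `m₀` serves all `B`.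
  · rw [Finset.card_compl, Nat.cast_sub hBN, Nat.cast_sub hBk]
    calc b * ((k : ℝ) - B.card) ≤ b * k :=
          mul_le_mul_of_nonneg_left (by linarith [(Nat.cast_nonneg B.card : (0 : ℝ) ≤ _)]) hb0
      _ ≤ _ := hm₀
      _ = _ := by ring

open Classical in
/-- Most regular index sets carry a small principal submatrix of a hollow matrix. -/
theorem card_regular_large_quadForm_mul_pow_le {Y : Matrix ι ι ℝ} (hY : ∀ i, Y i i = 0)
    {r b m₀ T s : ℝ} {k P : ℕ} (hr0 : 0 ≤ r) (hb0 : 0 ≤ b) (hT : 0 < T) (hs : 0 ≤ s)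
    (hk : k ≤ Fintype.card ι) (hP : 0 < P)
    (hm₀ : b * k ≤ m₀ * ((Fintype.card ι : ℝ) + 1 - k)) (hmT : m₀ * Real.exp (P * r / T) ≤ T) :
    (((Finset.univ.powersetCard k).filter fun I : Finset ι => Regular Y r b I ∧
        ∃ z : ι → ℝ, (∀ j ∉ I, z j = 0) ∧ s * (z ⬝ᵥ z) < |z ⬝ᵥ Y *ᵥ z|).card : ℝ) *
      s ^ (2 * P) ≤ 16 ^ P * ((Fintype.card ι).choose k * (Fintype.card ι * T ^ P)) := by
  set 𝒰 := (Finset.univ : Finset ι).powersetCard k with h𝒰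
  set F := 𝒰.filter fun I : Finset ι => Regular Y r b I ∧
        ∃ z : ι → ℝ, (∀ j ∉ I, z j = 0) ∧ s * (z ⬝ᵥ z) < |z ⬝ᵥ Y *ᵥ z| with hF
  set τ : Finset ι → Finset ι → ℝ := fun I B => (sampleGram (rowOn Y B) (I \ B) ^ P).trace with hτ
  have hτ0 : ∀ I B, 0 ≤ τ I B := fun I B => ((sampleGram_posSemidef _ _).pow P).trace_nonneg
  -- Regularity passes from I to its subset B. Keeping it only for B frees I to range over all
  -- k-sets containing B.
  set 𝒢 := (Finset.univ : Finset (Finset ι)).filter fun B => Regular Y r b B ∧ B.card ≤ k with h𝒢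
  have hcard : ∀ I ∈ 𝒰, I.card = k := fun I hI => (Finset.mem_powersetCard.1 hI).2
  have h1 : (F.card : ℝ) * (s ^ (2 * P) * 2 ^ k) ≤ 16 ^ P * ∑ I ∈ F, ∑ B ∈ I.powerset, τ I B := by
    rw [← nsmul_eq_mul, Finset.mul_sum]
    refine Finset.card_nsmul_le_sum _ _ _ fun I hI => ?_
    obtain ⟨hIU, -, z, hz, hsz⟩ := Finset.mem_filter.1 hI
    have := pow_mul_two_pow_le_sum_trace hY hz hs hsz hP
    rwa [hcard I hIU] at this
  have h2 : ∑ I ∈ F, ∑ B ∈ I.powerset, τ I B ≤ ∑ B ∈ 𝒢, ∑ I ∈ 𝒰.filter (B ⊆ ·), τ I B := by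
    rw [Finset.sum_comm' (t' := 𝒢) (s' := fun B => F.filter (B ⊆ ·))]
    · refine Finset.sum_le_sum fun B _ => Finset.sum_le_sum_of_subset_of_nonneg
        (Finset.filter_subset_filter _ (Finset.filter_subset _ _)) fun I _ _ => hτ0 I B
    · intro I B
      simp only [Finset.mem_powerset, Finset.mem_filter, h𝒢, Finset.mem_univ, true_and]
      constructor
      · rintro ⟨hI, hBI⟩
        obtain ⟨hIU, hreg, -⟩ := Finset.mem_filter.1 hI
        exact ⟨⟨hI, hBI⟩, hreg.mono hBI, (Finset.card_le_card hBI).trans (hcard I hIU).le⟩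
      · exact fun h => h.1
  have h3 : ∑ B ∈ 𝒢, ∑ I ∈ 𝒰.filter (B ⊆ ·), τ I B ≤
      ∑ B ∈ 𝒢, ((𝒰.filter (B ⊆ ·)).card : ℝ) * (Fintype.card ι * T ^ P) :=
    Finset.sum_le_sum fun B hB => by
      obtain ⟨-, hreg, hBk⟩ := Finset.mem_filter.1 hB
      exact hreg.sum_trace_le hr0 hb0 hT hk hBk hm₀ hmT
  -- Pairs B ⊆ I are counted from the side of I; the factor 2^k cancels the normalisation of the
  -- average over B.
  have h4 : ∑ B ∈ 𝒢, ((𝒰.filter (B ⊆ ·)).card : ℝ) ≤ (Fintype.card ι).choose k * 2 ^ k := by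
    calc ∑ B ∈ 𝒢, ((𝒰.filter (B ⊆ ·)).card : ℝ) ≤ ∑ B, ((𝒰.filter (B ⊆ ·)).card : ℝ) :=
          Finset.sum_le_sum_of_subset_of_nonneg (Finset.subset_univ _) fun _ _ _ => by positivity
      _ = ∑ I ∈ 𝒰, ((Finset.univ.filter (· ⊆ I)).card : ℝ) := by
          exact_mod_cast Finset.sum_card_bipartiteAbove_eq_sum_card_bipartiteBelow
            (s := (Finset.univ : Finset (Finset ι))) (t := 𝒰) (· ⊆ ·)
      _ = ∑ I ∈ 𝒰, (2 : ℝ) ^ k := by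
          refine Finset.sum_congr rfl fun I hI => ?_
          have : Finset.univ.filter (· ⊆ I) = I.powerset := by ext; simp
          rw [this, Finset.card_powerset, hcard I hI]; simp
      _ = _ := by simp [h𝒰, Finset.card_powersetCard]
  have h2k : (0 : ℝ) < 2 ^ k := by positivity
  refine le_of_mul_le_mul_right ?_ h2k
  calc (F.card : ℝ) * s ^ (2 * P) * 2 ^ k = (F.card : ℝ) * (s ^ (2 * P) * 2 ^ k) := by ring
    _ ≤ 16 ^ P * ∑ B ∈ 𝒢, ((𝒰.filter (B ⊆ ·)).card : ℝ) * (Fintype.card ι * T ^ P) :=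
        h1.trans (mul_le_mul_of_nonneg_left (h2.trans h3) (by positivity))
    _ = 16 ^ P * ((∑ B ∈ 𝒢, ((𝒰.filter (B ⊆ ·)).card : ℝ)) * (Fintype.card ι * T ^ P)) := by
        rw [← Finset.sum_mul]
    _ ≤ 16 ^ P * (((Fintype.card ι).choose k * 2 ^ k) * (Fintype.card ι * T ^ P)) := by
        gcongr
    _ = _ := by ring

end Decoupling

/-! ### Dual certificates for Basis Pursuit. -/

section Certificate

open Matrix

variable {m N : ℕ}

/-- A strict dual certificate together with injectivity on the support gives recovery. -/
theorem bpRecovers_of_certificate {Φ : Matrix (Fin m) (Fin N) ℝ} {x : Fin N → ℝ}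
    {J : Finset (Fin N)} (hx : ∀ j ∉ J, x j = 0)
    (hinj : ∀ z : Fin N → ℝ, (∀ j ∉ J, z j = 0) → Φ *ᵥ z = 0 → z = 0) {h : Fin m → ℝ}
    (hsign : ∀ i ∈ J, Φ.col i ⬝ᵥ h = Real.sign (x i)) (hlt : ∀ j ∉ J, |Φ.col j ⬝ᵥ h| < 1) :
    BPRecovers Φ x := by
  have hpair : ∀ w : Fin N → ℝ, h ⬝ᵥ Φ *ᵥ w = ∑ j, (Φ.col j ⬝ᵥ h) * w j := fun w => by
    rw [dotProduct_mulVec]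
    refine Finset.sum_congr rfl fun j _ => ?_
    congr 1
    exact dotProduct_comm _ _
  have hsgn : ∀ a : ℝ, Real.sign a * a = |a| := fun a => by
    rcases lt_trichotomy a 0 with h | h | h
    · rw [Real.sign_of_neg h, abs_of_neg h]; ring
    · simp [h]
    · rw [Real.sign_of_pos h, abs_of_pos h]; ring
  have hl1 : l1norm x = h ⬝ᵥ Φ *ᵥ x := by
    rw [hpair]
    refine Finset.sum_congr rfl fun j _ => ?_
    by_cases hj : j ∈ J
    · rw [hsign j hj, hsgn]
    · simp [hx j hj]
  have hle1 : ∀ j, |Φ.col j ⬝ᵥ h| ≤ 1 := fun j => by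
    by_cases hj : j ∈ J
    · rw [hsign j hj]
      rcases Real.sign_apply_eq (x j) with h | h | h <;> simp [h]
    · exact (hlt j hj).le
  have hterm : ∀ (w : Fin N → ℝ) j, (Φ.col j ⬝ᵥ h) * w j ≤ |w j| := fun w j => by
    calc (Φ.col j ⬝ᵥ h) * w j ≤ |(Φ.col j ⬝ᵥ h) * w j| := le_abs_self _
      _ = |Φ.col j ⬝ᵥ h| * |w j| := abs_mul _ _
      _ ≤ 1 * |w j| := mul_le_mul_of_nonneg_right (hle1 j) (abs_nonneg _)
      _ = _ := one_mul _
  have hle : ∀ w, Φ *ᵥ w = Φ *ᵥ x → l1norm x ≤ l1norm w := fun w hw => by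
    rw [hl1, ← hw, hpair]
    exact Finset.sum_le_sum fun j _ => hterm w j
  refine Set.eq_singleton_iff_unique_mem.2 ⟨⟨rfl, hle⟩, fun w hw => ?_⟩
  have heq : l1norm w ≤ h ⬝ᵥ Φ *ᵥ w := by
    rw [hw.1, ← hl1]; exact hw.2 x rfl
  -- A nonzero entry of a minimizer off `J` would make the duality inequality strict, since |⟨φ_j,
  -- h⟩| < 1 there.
  have hw0 : ∀ j ∉ J, w j = 0 := fun j hj => by
    by_contra hne
    rw [hpair] at heq
    refine absurd heq (not_le.2 (Finset.sum_lt_sum (fun i _ => hterm w i)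
      ⟨j, Finset.mem_univ j, ?_⟩))
    calc (Φ.col j ⬝ᵥ h) * w j ≤ |(Φ.col j ⬝ᵥ h) * w j| := le_abs_self _
      _ = |Φ.col j ⬝ᵥ h| * |w j| := abs_mul _ _
      _ < 1 * |w j| := mul_lt_mul_of_pos_right (hlt j hj) (abs_pos.2 hne)
      _ = _ := one_mul _
  have := hinj (w - x) (fun j hj => by simp [hw0 j hj, hx j hj])
    (by rw [mulVec_sub, hw.1, sub_self])
  exact sub_eq_zero.1 this

/-- The least-squares certificates `Φ_J (Φ_Jᵀ Φ_J)⁻¹ s`, as linear functions of the signs `s`. -/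
theorem exists_certificate_weights {Φ : Matrix (Fin m) (Fin N) ℝ} {J : Finset (Fin N)}
    (hlow : ∀ z : Fin N → ℝ, (∀ j ∉ J, z j = 0) → 1 / 2 * (z ⬝ᵥ z) ≤ (Φ *ᵥ z) ⬝ᵥ (Φ *ᵥ z)) :
    ∃ u : Fin N → J → ℝ,
      (∀ j, u j ⬝ᵥ u j ≤ 4 * ∑ i ∈ J, (Φ.col j ⬝ᵥ Φ.col i) ^ 2) ∧
      ∀ s : J → ℝ, ∃ h : Fin m → ℝ, (∀ i : J, Φ.col i ⬝ᵥ h = s i) ∧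
        ∀ j, Φ.col j ⬝ᵥ h = u j ⬝ᵥ s := by
  set Ψ : Matrix (Fin m) J ℝ := Φ.submatrix id Subtype.val with hΨ
  have hlow' : ∀ z : J → ℝ, 1 / 2 * (z ⬝ᵥ z) ≤ z ⬝ᵥ (Ψᵀ * Ψ) *ᵥ z := fun z => by
    set y : Fin N → ℝ := fun i => if h : i ∈ J then z ⟨i, h⟩ else 0 with hy
    have hyJ : ∀ i : J, y i = z i := fun i => by simp [hy]
    have hy0 : ∀ j ∉ J, y j = 0 := fun j hj => by simp [hy, hj]
    have h1 : ∀ f : Fin N → ℝ, (∀ j ∉ J, f j = 0) → ∑ j, f j = ∑ i : J, f i := fun f hf => by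
      rw [Finset.sum_coe_sort J f]
      exact (Finset.sum_subset (Finset.subset_univ J) fun j _ hj => hf j hj).symm
    have h2 : y ⬝ᵥ y = z ⬝ᵥ z := by
      rw [dotProduct, h1 _ fun j hj => by simp [hy0 j hj]]
      exact Finset.sum_congr rfl fun i _ => by rw [hyJ]
    have h3 : Φ *ᵥ y = Ψ *ᵥ z := by
      ext a
      simp only [mulVec, dotProduct]
      rw [h1 _ fun j hj => by simp [hy0 j hj]]
      exact Finset.sum_congr rfl fun i _ => by rw [hyJ]; rfl
    have := hlow y hy0
    rwa [h2, h3, dotProduct_mulVec, ← mulVec_transpose, mulVec_mulVec,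
      dotProduct_comm ((Ψᵀ * Ψ) *ᵥ z)] at this
  have hzz : ∀ z : J → ℝ, 0 ≤ z ⬝ᵥ z := fun z => Finset.sum_nonneg fun i _ => mul_self_nonneg _
  have hunit : IsUnit (Ψᵀ * Ψ) := by
    rw [← mulVec_injective_iff_isUnit]
    intro a b hab
    have h0 : (Ψᵀ * Ψ) *ᵥ (a - b) = 0 := by rw [mulVec_sub]; exact sub_eq_zero.2 hab
    have := hlow' (a - b)
    rw [h0, dotProduct_zero] at this
    exact sub_eq_zero.1 (dotProduct_self_eq_zero.1 (le_antisymm (by linarith) (hzz _)))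
  have hdet := (isUnit_iff_isUnit_det _).1 hunit
  set R := (Ψᵀ * Ψ)⁻¹ with hR
  have hRt : Rᵀ = R := by
    rw [hR, transpose_nonsing_inv, transpose_mul, transpose_transpose]
  have hcol : ∀ (j : Fin N) (i : J), (Ψᵀ *ᵥ Φ.col j) i = Φ.col j ⬝ᵥ Φ.col i := fun j i => by
    rw [dotProduct_comm]; rfl
  refine ⟨fun j => R *ᵥ (Ψᵀ *ᵥ Φ.col j), fun j => ?_, fun s => ⟨Ψ *ᵥ (R *ᵥ s), fun i => ?_,
    fun j => ?_⟩⟩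
  · set v := Ψᵀ *ᵥ Φ.col j with hv
    set u := R *ᵥ v with hu
    have hGu : (Ψᵀ * Ψ) *ᵥ u = v := by
      rw [hu, mulVec_mulVec, hR, mul_nonsing_inv _ hdet, one_mulVec]
    have h1 := hlow' u
    rw [hGu] at h1
    have h2 : (u ⬝ᵥ v) ^ 2 ≤ (u ⬝ᵥ u) * (v ⬝ᵥ v) := by
      have := Finset.sum_mul_sq_le_sq_mul_sq Finset.univ u v
      simpa [dotProduct, sq] using this
    have h3 : v ⬝ᵥ v = ∑ i ∈ J, (Φ.col j ⬝ᵥ Φ.col i) ^ 2 := by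
      rw [← Finset.sum_coe_sort J]
      exact Finset.sum_congr rfl fun i _ => by rw [hv, hcol, sq]
    rw [← h3]
    -- From |u|²/2 ≤ ⟨u, v⟩ ≤ |u| |v| follows |u| ≤ 2|v|, hence the constant 4; dividing by |u|²
    -- needs the case u = 0 apart.
    rcases (hzz u).eq_or_lt with h0 | h0
    · rw [← h0]; exact mul_nonneg (by norm_num) (hzz v)
    · refine le_of_mul_le_mul_left ?_ h0
      nlinarith [hzz u]
  · have : Φ.col i ⬝ᵥ Ψ *ᵥ (R *ᵥ s) = (Ψᵀ *ᵥ (Ψ *ᵥ (R *ᵥ s))) i := rfl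
    rw [this, mulVec_mulVec, mulVec_mulVec, hR, mul_nonsing_inv _ hdet, one_mulVec]
  · rw [dotProduct_mulVec, ← mulVec_transpose, dotProduct_mulVec, ← mulVec_transpose, hRt]

end Certificate

/-! ### Random signs: failure probability conditional on the support. -/

section Signs

open Matrix

/-- Hoeffding's inequality for a Rademacher sum. -/
theorem measure_one_le_abs_rademacher_sum_le {Ω κ : Type*} [MeasurableSpace Ω] [Fintype κ]
    {Q : Measure Ω} [IsProbabilityMeasure Q] {σ : κ → Ω → ℝ} (hσ : iIndepFun σ Q)
    (hmeas : ∀ i, Measurable (σ i)) (hpos : ∀ i, Q {ω | σ i ω = 1} = 2⁻¹)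
    (hneg : ∀ i, Q {ω | σ i ω = -1} = 2⁻¹) {u : κ → ℝ} {v : ℝ} (hv : u ⬝ᵥ u ≤ v) :
    Q {ω | 1 ≤ |u ⬝ᵥ fun i => σ i ω|} ≤ ENNReal.ofReal (2 * Real.exp (-1 / (2 * v))) := by
  have hmp : ∀ i, MeasurableSet {ω | σ i ω = 1} := fun i => hmeas i (measurableSet_singleton 1)
  have hmn : ∀ i, MeasurableSet {ω | σ i ω = -1} := fun i =>
    hmeas i (measurableSet_singleton (-1))
  have hae : ∀ i, ∀ᵐ ω ∂Q, σ i ω = 1 ∨ σ i ω = -1 := fun i => by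
    have hd : Disjoint {ω | σ i ω = 1} {ω | σ i ω = -1} := by
      rw [Set.disjoint_left]
      intro ω h1 h2
      have h1' : σ i ω = 1 := h1
      have h2' : σ i ω = -1 := h2
      linarith
    have h := measure_union (μ := Q) hd (hmn i)
    rw [hpos, hneg, ENNReal.inv_two_add_inv_two] at h
    have := (prob_compl_eq_zero_iff ((hmp i).union (hmn i))).2 h
    exact this
  have hint : ∀ i, ∫ ω, σ i ω ∂Q = 0 := fun i => by
    have h1 : σ i =ᵐ[Q] fun ω => ({ω | σ i ω = 1}.indicator (fun _ => (1 : ℝ)) ω) -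
        {ω | σ i ω = -1}.indicator (fun _ => (1 : ℝ)) ω := by
      filter_upwards [hae i] with ω hω
      rcases hω with h | h
      · simp [Set.indicator, h]; norm_num
      · simp [Set.indicator, h]; norm_num
    rw [integral_congr_ae h1, integral_sub, integral_indicator_const _ (hmp i),
      integral_indicator_const _ (hmn i)]
    · simp [Measure.real, hpos, hneg]
    · exact (integrable_const _).indicator (hmp i)
    · exact (integrable_const _).indicator (hmn i)
  have hsub : ∀ i, HasSubgaussianMGF (σ i) 1 Q := fun i => by
    have := hasSubgaussianMGF_of_mem_Icc_of_integral_eq_zero (a := -1) (b := 1)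
      (hmeas i).aemeasurable (by
        filter_upwards [hae i] with ω hω
        rcases hω with h | h <;> simp [h]) (hint i)
    convert this using 1
    ext
    norm_num
  have huu : ∀ w : κ → ℝ, 0 ≤ w ⬝ᵥ w := fun w => Finset.sum_nonneg fun i _ => mul_self_nonneg _
  have hv0 : 0 ≤ v := (huu u).trans hv
  have tail : ∀ w : κ → ℝ, w ⬝ᵥ w ≤ v →
      Q {ω | 1 ≤ w ⬝ᵥ fun i => σ i ω} ≤ ENNReal.ofReal (Real.exp (-1 / (2 * v))) := by
    intro w hw
    have hI : iIndepFun (fun i ω => w i * σ i ω) Q :=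
      hσ.comp (fun i y => w i * y) fun i => measurable_const_mul (w i)
    have hS := HasSubgaussianMGF.sum_of_iIndepFun hI (s := Finset.univ)
      (c := fun i => Real.toNNReal (w i ^ 2)) fun i _ => by
        convert (hsub i).const_mul (w i) using 1
        ext
        exact (Real.coe_toNNReal _ (sq_nonneg (w i))).trans (mul_one (w i ^ 2)).symm
    have hS' : HasSubgaussianMGF (fun ω => ∑ i, w i * σ i ω) (Real.toNNReal v) Q := by
      refine ⟨hS.integrable_exp_mul, fun t => (hS.mgf_le t).trans ?_⟩
      refine Real.exp_le_exp.2 ?_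
      have : ((∑ i, Real.toNNReal (w i ^ 2) : NNReal) : ℝ) ≤ (Real.toNNReal v : ℝ) := by
        rw [Real.coe_toNNReal v hv0, NNReal.coe_sum]
        refine le_trans (le_of_eq (Finset.sum_congr rfl fun i _ => ?_)) hw
        rw [Real.coe_toNNReal _ (sq_nonneg _), sq]
      gcongr
    have := hS'.measure_ge_le (ε := 1) zero_le_one
    rw [one_pow, Real.coe_toNNReal v hv0] at this
    rw [← ofReal_measureReal]
    exact ENNReal.ofReal_le_ofReal this
  have hsubset : {ω | 1 ≤ |u ⬝ᵥ fun i => σ i ω|} ⊆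
      {ω | 1 ≤ u ⬝ᵥ fun i => σ i ω} ∪ {ω | 1 ≤ (-u) ⬝ᵥ fun i => σ i ω} := by
    intro ω hω
    rcases le_abs.1 (show 1 ≤ |u ⬝ᵥ fun i => σ i ω| from hω) with h | h
    · exact Or.inl h
    · exact Or.inr (by simpa [neg_dotProduct] using h)
  calc _ ≤ _ := measure_mono hsubset
    _ ≤ _ := measure_union_le _ _
    _ ≤ ENNReal.ofReal (Real.exp (-1 / (2 * v))) + ENNReal.ofReal (Real.exp (-1 / (2 * v))) :=
        add_le_add (tail u hv) (tail (-u) (by simpa using hv))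
    _ = _ := by
        rw [← ENNReal.ofReal_add (by positivity) (by positivity)]
        congr 1; ring

theorem measurable_sign : Measurable Real.sign := by
  have : Real.sign = fun r : ℝ => if r < 0 then (-1 : ℝ) else if 0 < r then 1 else 0 := by
    ext r; rfl
  rw [this]
  exact Measurable.ite measurableSet_Iio measurable_const
    (Measurable.ite measurableSet_Ioi measurable_const measurable_const)

/-- The index sets `J` on which random signs are recovered with overwhelming probability. -/
def WellConditioned {m N : ℕ} (Φ : Matrix (Fin m) (Fin N) ℝ) (a : ℝ) (J : Finset (Fin N)) :
    Prop :=
  (∀ z : Fin N → ℝ, (∀ j ∉ J, z j = 0) → 1 / 2 * (z ⬝ᵥ z) ≤ (Φ *ᵥ z) ⬝ᵥ (Φ *ᵥ z)) ∧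
    ∀ j ∉ J, ∑ i ∈ J, (Φ.col j ⬝ᵥ Φ.col i) ^ 2 ≤ a

theorem WellConditioned.cond_measure_not_bpRecovers_le {m N : ℕ} {Φ : Matrix (Fin m) (Fin N) ℝ}
    {a : ℝ} {J : Finset (Fin N)} (hJ : WellConditioned Φ a J) {Ω : Type*} [MeasurableSpace Ω]
    {Q : Measure Ω} [IsProbabilityMeasure Q] {x : Ω → Fin N → ℝ} (hx : Measurable x)
    (hsparse : ∀ᵐ ω ∂Q, IsSparse J.card (x ω))
    (hindep : iIndepFun (fun (i : J) (ω : Ω) => Real.sign (x ω i)) Q)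
    (hsign : ∀ i ∈ J, Q {ω | Real.sign (x ω i) = 1} = 2⁻¹ ∧
      Q {ω | Real.sign (x ω i) = -1} = 2⁻¹) :
    Q {ω | ¬ BPRecovers Φ (x ω)} ≤ ENNReal.ofReal (N * (2 * Real.exp (-1 / (8 * a)))) := by
  obtain ⟨u, hu, hcert⟩ := exists_certificate_weights hJ.1
  have hxi : ∀ i, Measurable fun ω => x ω i := fun i => (measurable_pi_apply i).comp hx
  have hm : ∀ i : J, Measurable fun ω => Real.sign (x ω i) := fun i =>
    measurable_sign.comp (hxi i)
  have hne : ∀ i ∈ J, ∀ᵐ ω ∂Q, x ω i ≠ 0 := fun i hi => by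
    have hd : Disjoint {ω | Real.sign (x ω i) = 1} {ω | Real.sign (x ω i) = -1} := by
      rw [Set.disjoint_left]
      intro ω h1 h2
      have h1' : Real.sign (x ω i) = 1 := h1
      have h2' : Real.sign (x ω i) = -1 := h2
      linarith
    have hmn : MeasurableSet {ω | Real.sign (x ω i) = -1} :=
      hm ⟨i, hi⟩ (measurableSet_singleton (-1))
    have hmp : MeasurableSet {ω | Real.sign (x ω i) = 1} :=
      hm ⟨i, hi⟩ (measurableSet_singleton 1)
    have h := measure_union (μ := Q) hd hmn
    rw [(hsign i hi).1, (hsign i hi).2, ENNReal.inv_two_add_inv_two] at h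
    have h0 : ∀ᵐ ω ∂Q, ω ∈ {ω | Real.sign (x ω i) = 1} ∪ {ω | Real.sign (x ω i) = -1} :=
      (prob_compl_eq_zero_iff (hmp.union hmn)).2 h
    filter_upwards [h0] with ω hω h0
    rcases hω with h | h
    · simp [h0] at h
    · simp [h0] at h
  have hne' : ∀ᵐ ω ∂Q, ∀ i ∈ J, x ω i ≠ 0 := by
    rw [Filter.eventually_all_finset]
    exact hne
  set E : Fin N → Set Ω := fun j =>
    if j ∈ J then ∅ else {ω | 1 ≤ |u j ⬝ᵥ fun i : J => Real.sign (x ω i)|} with hE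
  have hsub : ∀ᵐ ω ∂Q, ω ∈ {ω | ¬ BPRecovers Φ (x ω)} → ω ∈ ⋃ j, E j := by
    filter_upwards [hne', hsparse] with ω hω hsp hbp
    by_contra hnot
    refine hbp ?_
    -- All |J| entries on `J` are nonzero because their signs are ±1, so sparsity leaves no other
    -- nonzero entry.
    have hsupp : J = Finset.univ.filter fun i => x ω i ≠ 0 :=
      Finset.eq_of_subset_of_card_le (fun i hi => by simpa using hω i hi) hsp
    obtain ⟨h, h1, h2⟩ := hcert fun i => Real.sign (x ω i)
    refine bpRecovers_of_certificate (J := J) (h := h) (fun j hj => ?_) ?_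
      (fun i hi => h1 ⟨i, hi⟩) fun j hj => ?_
    · rw [hsupp] at hj
      simpa using hj
    · intro z hz hz0
      have := hJ.1 z hz
      rw [hz0, dotProduct_zero] at this
      have h0 : 0 ≤ z ⬝ᵥ z := Finset.sum_nonneg fun i _ => mul_self_nonneg _
      exact dotProduct_self_eq_zero.1 (le_antisymm (by linarith) h0)
    · rw [h2]
      by_contra hge
      refine hnot (Set.mem_iUnion.2 ⟨j, ?_⟩)
      simp only [hE, hj, if_false]
      exact not_lt.1 hge
  calc Q {ω | ¬ BPRecovers Φ (x ω)} ≤ Q (⋃ j, E j) := measure_mono_ae hsub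
    _ ≤ ∑ j, Q (E j) := measure_iUnion_fintype_le _ _
    _ ≤ ∑ _j : Fin N, ENNReal.ofReal (2 * Real.exp (-1 / (8 * a))) := by
        refine Finset.sum_le_sum fun j _ => ?_
        by_cases hj : j ∈ J
        · simp [hE, hj]
        · simp only [hE, hj, if_false]
          have := measure_one_le_abs_rademacher_sum_le (v := 4 * a) hindep hm
            (fun i => (hsign i i.2).1) (fun i => (hsign i i.2).2)
            ((hu j).trans (mul_le_mul_of_nonneg_left (hJ.2 j hj) (by norm_num)))
          rwa [show 2 * (4 * a) = 8 * a by ring] at this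
    _ = _ := by
        rw [Finset.sum_const, Finset.card_univ, Fintype.card_fin, nsmul_eq_mul,
          ENNReal.ofReal_mul (Nat.cast_nonneg N), ENNReal.ofReal_natCast]

open Classical in
/-- Recovery of a sparse generic random signal from a count of the ill-conditioned supports. -/
theorem measure_not_bpRecovers_le {m N k : ℕ} {Φ : Matrix (Fin m) (Fin N) ℝ} {a δ : ℝ}
    (hk : k ≤ N) (hδ : 0 ≤ δ)
    (hbad : (((Finset.univ.powersetCard k).filter fun J => ¬ WellConditioned Φ a J).card : ℝ) ≤
      δ * N.choose k)
    {Ω : Type*} [MeasurableSpace Ω] {P : Measure Ω} [IsProbabilityMeasure P] {x : Ω → Fin N → ℝ}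
    (hx : IsGenericRandomSignal P k x) (hsparse : ∀ᵐ ω ∂P, IsSparse k (x ω)) :
    P {ω | ¬ BPRecovers Φ (x ω)} ≤
      ENNReal.ofReal (δ + N * (2 * Real.exp (-1 / (8 * a)))) := by
  obtain ⟨hxm, I, hIm, hIae, hIJ⟩ := hx
  set S := {ω | ¬ BPRecovers Φ (x ω)} with hS
  set 𝒰 := (Finset.univ : Finset (Fin N)).powersetCard k with h𝒰
  set q : ℝ := N * (2 * Real.exp (-1 / (8 * a))) with hq
  have hq0 : 0 ≤ q := by positivity
  have hc0 : (N.choose k : ENNReal) ≠ 0 := by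
    exact_mod_cast (Nat.choose_pos hk).ne'
  have hct : (N.choose k : ENNReal) ≠ ⊤ := ENNReal.natCast_ne_top _
  have hcov : P S ≤ ∑ J ∈ 𝒰, P ({ω | I ω = J} ∩ S) := by
    refine le_trans (measure_mono_ae ?_) (measure_biUnion_finset_le 𝒰 fun J => {ω | I ω = J} ∩ S)
    filter_upwards [hIae] with ω hω hωS
    refine Set.mem_biUnion (x := I ω) ?_ ⟨rfl, hωS⟩
    simp [h𝒰, Finset.mem_powersetCard, hω.1]
  have hterm : ∀ J ∈ 𝒰, P ({ω | I ω = J} ∩ S) ≤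
      (N.choose k : ENNReal)⁻¹ * ((if WellConditioned Φ a J then 0 else 1) + ENNReal.ofReal q) := by
    intro J hJ
    have hJk : J.card = k := (Finset.mem_powersetCard.1 hJ).2
    obtain ⟨hPJ, hind, hsgn⟩ := hIJ J hJk
    by_cases hw : WellConditioned Φ a J
    · have hP0 : P {ω | I ω = J} ≠ 0 := by
        rw [hPJ]; exact ENNReal.inv_ne_zero.2 hct
      have : IsProbabilityMeasure (cond P {ω | I ω = J}) := cond_isProbabilityMeasure hP0
      rw [if_pos hw, zero_add, ← cond_mul_eq_inter (hIm J), hPJ, mul_comm]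
      gcongr
      refine hw.cond_measure_not_bpRecovers_le hxm ?_ hind hsgn
      rw [hJk]
      exact cond_absolutelyContinuous.ae_le hsparse
    · rw [if_neg hw]
      calc P ({ω | I ω = J} ∩ S) ≤ P {ω | I ω = J} := measure_mono Set.inter_subset_left
        _ = (N.choose k : ENNReal)⁻¹ * 1 := by rw [hPJ, mul_one]
        _ ≤ _ := by gcongr; exact le_self_add
  refine hcov.trans ((Finset.sum_le_sum hterm).trans ?_)
  have hcard : 𝒰.card = N.choose k := by simp [h𝒰, Finset.card_powersetCard]
  have hsum : ∑ J ∈ 𝒰, (if WellConditioned Φ a J then 0 else 1 : ENNReal) =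
      ((𝒰.filter fun J => ¬ WellConditioned Φ a J).card : ENNReal) := by
    rw [Finset.card_filter]
    push_cast
    exact Finset.sum_congr rfl fun J _ => by by_cases h : WellConditioned Φ a J <;> simp [h]
  rw [← Finset.mul_sum, Finset.sum_add_distrib, hsum, Finset.sum_const, hcard, nsmul_eq_mul,
    mul_add, ← mul_assoc, ENNReal.inv_mul_cancel hc0 hct, one_mul, ENNReal.ofReal_add hδ hq0]
  gcongr
  rw [← ENNReal.div_eq_inv_mul]
  refine ENNReal.div_le_of_le_mul ?_
  rw [← ENNReal.ofReal_natCast, ← ENNReal.ofReal_natCast, ← ENNReal.ofReal_mul hδ]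
  exact ENNReal.ofReal_le_ofReal hbad

end Signs

/-! ### Counting the ill-conditioned supports. -/

section Conditioning

open Matrix

variable {ι : Type*} [Fintype ι] [DecidableEq ι]

/-- A threshold e times the moment scale turns a moment of order `P` into a tail e^{-P}. -/
theorem le_mul_exp_neg_of_mul_pow_le {F A t : ℝ} {P : ℕ} (ht : 0 < t)
    (h : F * t ^ P ≤ A * (t / Real.exp 1) ^ P) : F ≤ A * Real.exp (-P) := by
  have htP : 0 < t ^ P := pow_pos ht P
  refine le_of_mul_le_mul_right (h.trans (le_of_eq ?_)) htP
  rw [div_pow, ← Real.exp_nat_mul, mul_one, Real.exp_neg]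
  field_simp

open Classical in
theorem card_long_row_le {Y : Matrix ι ι ℝ} {r b m₀ t : ℝ} {k P : ℕ}
    (hr : ∀ i j, Y i j ^ 2 ≤ r) (hr0 : 0 ≤ r) (hb0 : 0 ≤ b) (hb : ∀ i, ∑ j, Y i j ^ 2 ≤ b)
    (ht : 0 < t) (hk : k ≤ Fintype.card ι) (hm₀ : b * k ≤ m₀ * ((Fintype.card ι : ℝ) + 1 - k))
    (hmt : m₀ * Real.exp (P * r / (t / Real.exp 1)) ≤ t / Real.exp 1) :
    (((Finset.univ.powersetCard k).filter fun I : Finset ι =>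
      ∃ i, t < ∑ j ∈ I, Y i j ^ 2).card : ℝ) ≤
      (Fintype.card ι).choose k * (Fintype.card ι * Real.exp (-P)) := by
  have hrow : ∀ i, (((Finset.univ.powersetCard k).filter fun I : Finset ι =>
      t < ∑ j ∈ I, Y i j ^ 2).card : ℝ) ≤ (Fintype.card ι).choose k * Real.exp (-P) := by
    intro i
    refine le_mul_exp_neg_of_mul_pow_le ht ?_
    -- The entries of one row are vectors in dimension one, so the matrix tail bound becomes a
    -- scalar bound for sampling without replacement.
    have := card_exceeding_sampleGram_mul_pow_le (n := Unit) (ι := ι) (U := Finset.univ)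
      (x := fun j _ => Y i j) (b := b) (r := r) (m₀ := m₀) (T := t / Real.exp 1) (t := t) (k := k)
      (P := P) hr0 (fun j _ => by simpa [dotProduct, sq] using hr i j) hb0
      (fun z => by
        simp only [dotProduct, Finset.univ_unique, Finset.sum_singleton, mul_pow]
        rw [← Finset.sum_mul, ← sq]
        exact mul_le_mul_of_nonneg_right (hb i) (sq_nonneg _))
      (by positivity) ht.le (by simpa using hk) (by simpa using hm₀) hmt
    rw [Finset.card_univ, Fintype.card_unit, Nat.cast_one, one_mul] at this
    refine le_trans (mul_le_mul_of_nonneg_right ?_ (by positivity)) this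
    refine Nat.cast_le.2 (Finset.card_le_card (Finset.monotone_filter_right _ fun I _ hI => ?_))
    exact ⟨fun _ => 1, by simpa [dotProduct] using hI⟩
  have hsub : ((Finset.univ.powersetCard k).filter fun I : Finset ι =>
      ∃ i, t < ∑ j ∈ I, Y i j ^ 2) ⊆ Finset.univ.biUnion fun i =>
      (Finset.univ.powersetCard k).filter fun I : Finset ι => t < ∑ j ∈ I, Y i j ^ 2 := by
    intro I hI
    obtain ⟨h1, i, hi⟩ := Finset.mem_filter.1 hI
    exact Finset.mem_biUnion.2 ⟨i, Finset.mem_univ i, Finset.mem_filter.2 ⟨h1, hi⟩⟩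
  calc _ ≤ ((∑ i, ((Finset.univ.powersetCard k).filter fun I : Finset ι =>
          t < ∑ j ∈ I, Y i j ^ 2).card : ℕ) : ℝ) :=
        Nat.cast_le.2 ((Finset.card_le_card hsub).trans Finset.card_biUnion_le)
    _ ≤ ∑ _i : ι, (Fintype.card ι).choose k * Real.exp (-P) := by
        push_cast
        exact Finset.sum_le_sum fun i _ => hrow i
    _ = _ := by rw [Finset.sum_const, Finset.card_univ, nsmul_eq_mul]; ring

-- The tail bound controls sampled rows, ∑_{i ∈ I} ⟨Y_i, w⟩² ≤ t |w|². Symmetry and duality, with w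
-- = Y z, turn this into a bound for Y on vectors supported in I.
open Classical in
theorem card_large_columns_le {Y : Matrix ι ι ℝ} (hYs : Yᵀ = Y) {r b m₀ t : ℝ} {k P : ℕ}
    (hr0 : 0 ≤ r) (hr : ∀ i, ∑ j, Y i j ^ 2 ≤ r) (hb0 : 0 ≤ b)
    (hb : ∀ z, (Y *ᵥ z) ⬝ᵥ (Y *ᵥ z) ≤ b * (z ⬝ᵥ z)) (ht : 0 < t)
    (hk : k ≤ Fintype.card ι) (hm₀ : b * k ≤ m₀ * ((Fintype.card ι : ℝ) + 1 - k))
    (hmt : m₀ * Real.exp (P * r / (t / Real.exp 1)) ≤ t / Real.exp 1) :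
    (((Finset.univ.powersetCard k).filter fun I : Finset ι => ¬ ∀ z : ι → ℝ, (∀ j ∉ I, z j = 0) →
      (Y *ᵥ z) ⬝ᵥ (Y *ᵥ z) ≤ t * (z ⬝ᵥ z)).card : ℝ) ≤
      (Fintype.card ι).choose k * Fintype.card ι * Real.exp (-P) := by
  refine le_mul_exp_neg_of_mul_pow_le ht ?_
  have := card_exceeding_sampleGram_mul_pow_le (n := ι) (ι := ι) (U := Finset.univ)
      (x := fun i => Y i) (b := b) (r := r) (m₀ := m₀) (T := t / Real.exp 1) (t := t) (k := k)
      (P := P) hr0 (fun i _ => by simpa [dotProduct, sq] using hr i) hb0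
      (fun z => by simpa [dotProduct, mulVec, sq] using hb z)
      (by positivity) ht.le (by simpa using hk) (by simpa using hm₀) hmt
  rw [Finset.card_univ, ← mul_assoc] at this
  refine le_trans (mul_le_mul_of_nonneg_right ?_ (by positivity)) this
  refine Nat.cast_le.2 (Finset.card_le_card (Finset.monotone_filter_right _ fun I _ hI => ?_))
  by_contra hcon
  push Not at hcon
  refine hI fun z hz => ?_
  set w := Y *ᵥ z with hw
  have hww : 0 ≤ w ⬝ᵥ w := Finset.sum_nonneg fun i _ => mul_self_nonneg _
  have hzz : 0 ≤ z ⬝ᵥ z := Finset.sum_nonneg fun i _ => mul_self_nonneg _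
  have h1 : w ⬝ᵥ w = ∑ i ∈ I, (Y i ⬝ᵥ w) * z i := by
    have : w ⬝ᵥ w = (Y *ᵥ w) ⬝ᵥ z := by
      nth_rewrite 2 [hw]
      rw [dotProduct_mulVec, ← mulVec_transpose, hYs]
    rw [this]
    refine (Finset.sum_subset (Finset.subset_univ I) fun i _ hi => ?_).symm
    simp [hz i hi]
  have h2 : (w ⬝ᵥ w) ^ 2 ≤ (t * (w ⬝ᵥ w)) * (z ⬝ᵥ z) := by
    calc (w ⬝ᵥ w) ^ 2 = (∑ i ∈ I, (Y i ⬝ᵥ w) * z i) ^ 2 := by rw [← h1]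
      _ ≤ (∑ i ∈ I, (Y i ⬝ᵥ w) ^ 2) * ∑ i ∈ I, z i ^ 2 := Finset.sum_mul_sq_le_sq_mul_sq _ _ _
      _ ≤ _ := by
          refine mul_le_mul (hcon w) ?_ (Finset.sum_nonneg fun _ _ => sq_nonneg _) (by positivity)
          simp only [dotProduct, ← sq]
          exact Finset.sum_le_sum_of_subset_of_nonneg (Finset.subset_univ _)
            fun _ _ _ => sq_nonneg _
  rcases hww.eq_or_lt with h0 | h0
  · rw [← h0]; positivity
  · refine le_of_mul_le_mul_left ?_ h0
    nlinarith

/-- `A` with its diagonal replaced by zero. -/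
def hollow {ι : Type*} [DecidableEq ι] (A : Matrix ι ι ℝ) : Matrix ι ι ℝ :=
  of fun i j => if i = j then 0 else A i j

theorem hollow_mulVec (A : Matrix ι ι ℝ) (z : ι → ℝ) :
    hollow A *ᵥ z = A *ᵥ z - fun i => A i i * z i := by
  have : hollow A = A - diagonal fun i => A i i := by
    ext i j
    by_cases h : i = j
    · subst h; simp [hollow]
    · simp [hollow, h]
  rw [this, sub_mulVec]
  congr 1
  ext i
  simp [mulVec_diagonal]

open Classical in
/-- If every kind of failure is rare, then so are the ill-conditioned index sets. -/
theorem card_not_wellConditioned_le {m N k : ℕ} {Φ : Matrix (Fin m) (Fin N) ℝ}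
    {Y : Matrix (Fin N) (Fin N) ℝ} {a b D : ℝ}
    (hlow : ∀ z, 3 / 4 * (z ⬝ᵥ z) + z ⬝ᵥ Y *ᵥ z ≤ (Φ *ᵥ z) ⬝ᵥ (Φ *ᵥ z))
    (hX : (((Finset.univ.powersetCard k).filter fun I : Finset (Fin N) =>
      ∃ i, a < ∑ j ∈ I, hollow (Φᵀ * Φ) i j ^ 2).card : ℝ) ≤ D)
    (hY : (((Finset.univ.powersetCard k).filter fun I : Finset (Fin N) =>
      ∃ i, a < ∑ j ∈ I, Y i j ^ 2).card : ℝ) ≤ D)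
    (hcol : (((Finset.univ.powersetCard k).filter fun I : Finset (Fin N) =>
      ¬ ∀ z : Fin N → ℝ, (∀ j ∉ I, z j = 0) →
        (Y *ᵥ z) ⬝ᵥ (Y *ᵥ z) ≤ b * (z ⬝ᵥ z)).card : ℝ) ≤ D)
    (hreg : (((Finset.univ.powersetCard k).filter fun I : Finset (Fin N) => Regular Y a b I ∧
      ∃ z : Fin N → ℝ, (∀ j ∉ I, z j = 0) ∧
        1 / 4 * (z ⬝ᵥ z) < |z ⬝ᵥ Y *ᵥ z|).card : ℝ) ≤ D) :
    (((Finset.univ.powersetCard k).filter fun I => ¬ WellConditioned Φ a I).card : ℝ) ≤ 4 * D := by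
  set F₁ := (Finset.univ.powersetCard k).filter fun I : Finset (Fin N) =>
      ∃ i, a < ∑ j ∈ I, hollow (Φᵀ * Φ) i j ^ 2
  set F₂ := (Finset.univ.powersetCard k).filter fun I : Finset (Fin N) =>
      ∃ i, a < ∑ j ∈ I, Y i j ^ 2
  set F₃ := (Finset.univ.powersetCard k).filter fun I : Finset (Fin N) =>
      ¬ ∀ z : Fin N → ℝ, (∀ j ∉ I, z j = 0) → (Y *ᵥ z) ⬝ᵥ (Y *ᵥ z) ≤ b * (z ⬝ᵥ z)
  set F₄ := (Finset.univ.powersetCard k).filter fun I : Finset (Fin N) => Regular Y a b I ∧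
      ∃ z : Fin N → ℝ, (∀ j ∉ I, z j = 0) ∧ 1 / 4 * (z ⬝ᵥ z) < |z ⬝ᵥ Y *ᵥ z|
  have hsub : ((Finset.univ.powersetCard k).filter fun I => ¬ WellConditioned Φ a I) ⊆
      F₁ ∪ F₂ ∪ F₃ ∪ F₄ := by
    intro I hI
    obtain ⟨hIk, hbad⟩ := Finset.mem_filter.1 hI
    by_contra hnot
    simp only [Finset.mem_union, not_or] at hnot
    obtain ⟨⟨⟨h1, h2⟩, h3⟩, h4⟩ := hnot
    have h1' : ∀ i, ∑ j ∈ I, hollow (Φᵀ * Φ) i j ^ 2 ≤ a := fun i =>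
      not_lt.1 fun h => h1 (Finset.mem_filter.2 ⟨hIk, i, h⟩)
    have h2' : ∀ i, ∑ j ∈ I, Y i j ^ 2 ≤ a := fun i =>
      not_lt.1 fun h => h2 (Finset.mem_filter.2 ⟨hIk, i, h⟩)
    have h3' : ∀ z : Fin N → ℝ, (∀ j ∉ I, z j = 0) →
        (Y *ᵥ z) ⬝ᵥ (Y *ᵥ z) ≤ b * (z ⬝ᵥ z) :=
      not_not.1 fun h => h3 (Finset.mem_filter.2 ⟨hIk, h⟩)
    refine hbad ⟨fun z hz => ?_, fun j hj => ?_⟩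
    · have : |z ⬝ᵥ Y *ᵥ z| ≤ 1 / 4 * (z ⬝ᵥ z) :=
        not_lt.1 fun h => h4 (Finset.mem_filter.2 ⟨hIk, ⟨h2', h3'⟩, z, hz, h⟩)
      linarith [hlow z, neg_abs_le (z ⬝ᵥ Y *ᵥ z)]
    · refine le_trans (le_of_eq (Finset.sum_congr rfl fun i hi => ?_)) (h1' j)
      have hji : j ≠ i := fun h => hj (h ▸ hi)
      simp only [hollow, of_apply, hji, if_false]
      rfl
  have hcard := Finset.card_le_card hsub
  have h5 := Finset.card_union_le (F₁ ∪ F₂ ∪ F₃) F₄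
  have h6 := Finset.card_union_le (F₁ ∪ F₂) F₃
  have h7 := Finset.card_union_le F₁ F₂
  have h8 : (((Finset.univ.powersetCard k).filter fun I => ¬ WellConditioned Φ a I).card : ℝ) ≤
      F₁.card + F₂.card + F₃.card + F₄.card := by
    exact_mod_cast (by omega)
  linarith

/-- The truncated hollow Gram matrix. -/
theorem exists_hollow_minorant {m N : ℕ} {Φ : Matrix (Fin m) (Fin N) ℝ}
    (hdiag : ∀ j, (Φᵀ * Φ) j j = 1) {ρ κ : ℝ} (hκ : 1 ≤ κ)
    (hρ : ∀ i, ∑ j, (Φᵀ * Φ) i j ^ 2 ≤ ρ) (hρκ : ρ ≤ κ / 4) :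
    ∃ Y : Matrix (Fin N) (Fin N) ℝ, (∀ i, Y i i = 0) ∧ Yᵀ = Y ∧
      (∀ z, 3 / 4 * (z ⬝ᵥ z) + z ⬝ᵥ Y *ᵥ z ≤ (Φ *ᵥ z) ⬝ᵥ (Φ *ᵥ z)) ∧
      (∀ z, (Y *ᵥ z) ⬝ᵥ (Y *ᵥ z) ≤ 4 * κ ^ 2 * (z ⬝ᵥ z)) ∧
      (∀ i, ∑ j, Y i j ^ 2 ≤ ρ) ∧
      ∀ i j, i ≠ j → |Y i j| ≤ |(Φᵀ * Φ) i j| + ρ / κ := by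
  have hκ0 : 0 < κ := by linarith
  set G := Φᵀ * Φ with hG
  have hGpsd : G.PosSemidef := by
    simpa using posSemidef_conjTranspose_mul_self Φ
  obtain ⟨B, hB, hAB, hAAB, hBB, hBκ⟩ := exists_spectral_truncation hGpsd hκ0
  have hBs : Bᵀ = B := by simpa [IsSymm] using hB.1
  have hGs : Gᵀ = G := by simp [hG]
  have hdiagnn : ∀ {M : Matrix (Fin N) (Fin N) ℝ}, M.PosSemidef → ∀ i, 0 ≤ M i i :=
    fun hM i => hM.diag_nonneg
  have hsqdiag : ∀ {M : Matrix (Fin N) (Fin N) ℝ}, Mᵀ = M → ∀ i, (M ^ 2) i i = ∑ j, M i j ^ 2 :=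
    fun {M} hM i => by
      rw [sq, mul_apply]
      refine Finset.sum_congr rfl fun j _ => ?_
      have : M j i = M i j := congrFun (congrFun hM i) j
      rw [this, sq]
  -- The truncation loss is at most G²/κ, and the diagonal of G² consists of the row sums of
  -- squares.
  have hloss : ∀ i, G i i - B i i ≤ ρ / κ := fun i => by
    have h := hdiagnn hAAB i
    simp only [Matrix.sub_apply, Matrix.smul_apply, smul_eq_mul] at h
    rw [hsqdiag hGs] at h
    have h2 : κ⁻¹ * ∑ j, G i j ^ 2 ≤ κ⁻¹ * ρ :=
      mul_le_mul_of_nonneg_left (hρ i) (inv_nonneg.2 hκ0.le)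
    rw [div_eq_inv_mul]
    linarith
  have hloss4 : ρ / κ ≤ 1 / 4 := by
    rw [div_le_iff₀ hκ0]; linarith
  have hBdiag : ∀ i, 3 / 4 ≤ B i i ∧ B i i ≤ 1 := fun i => by
    have h1 := hloss i
    have h2 := hdiagnn hAB i
    simp only [Matrix.sub_apply] at h2
    rw [hdiag i] at h1 h2
    constructor <;> linarith
  have hzz : ∀ z : Fin N → ℝ, 0 ≤ z ⬝ᵥ z := fun z =>
    Finset.sum_nonneg fun i _ => mul_self_nonneg _
  refine ⟨hollow B, fun i => by simp [hollow], ?_, fun z => ?_, fun z => ?_, fun i => ?_,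
    fun i j hij => ?_⟩
  · ext i j
    have : B j i = B i j := congrFun (congrFun hBs i) j
    by_cases h : i = j
    · subst h; rfl
    · simp [hollow, h, Ne.symm h, this]
  · have h1 : (Φ *ᵥ z) ⬝ᵥ (Φ *ᵥ z) = z ⬝ᵥ G *ᵥ z := by
      rw [dotProduct_mulVec, ← mulVec_transpose, mulVec_mulVec, dotProduct_comm]
    have h2 : 0 ≤ z ⬝ᵥ (G - B) *ᵥ z := by simpa using hAB.dotProduct_mulVec_nonneg z
    rw [sub_mulVec, dotProduct_sub] at h2
    have h3 : 3 / 4 * (z ⬝ᵥ z) ≤ z ⬝ᵥ fun i => B i i * z i := by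
      simp only [dotProduct, Finset.mul_sum]
      refine Finset.sum_le_sum fun i _ => ?_
      nlinarith [(hBdiag i).1, mul_self_nonneg (z i)]
    rw [hollow_mulVec, dotProduct_sub, h1]
    linarith
  · have h1 : (B *ᵥ z) ⬝ᵥ (B *ᵥ z) ≤ κ ^ 2 * (z ⬝ᵥ z) := by
      have := hBκ z
      rwa [sq, ← mulVec_mulVec, dotProduct_mulVec, ← mulVec_transpose, hBs] at this
    set d : Fin N → ℝ := fun i => B i i * z i with hd
    have h2 : d ⬝ᵥ d ≤ κ ^ 2 * (z ⬝ᵥ z) := by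
      simp only [dotProduct, Finset.mul_sum]
      refine Finset.sum_le_sum fun i _ => ?_
      have h3 : B i i ^ 2 ≤ κ ^ 2 :=
        pow_le_pow_left₀ (by linarith [(hBdiag i).1]) ((hBdiag i).2.trans hκ) 2
      have : d i * d i = B i i ^ 2 * (z i * z i) := by simp only [hd]; ring
      rw [this]
      exact mul_le_mul_of_nonneg_right h3 (mul_self_nonneg _)
    rw [hollow_mulVec]
    have h4 : (B *ᵥ z - d) ⬝ᵥ (B *ᵥ z - d) ≤ 2 * ((B *ᵥ z) ⬝ᵥ (B *ᵥ z)) + 2 * (d ⬝ᵥ d) := by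
      simp only [dotProduct, Finset.mul_sum, ← Finset.sum_add_distrib]
      refine Finset.sum_le_sum fun i _ => ?_
      simp only [Pi.sub_apply]
      nlinarith [sq_nonneg ((B *ᵥ z) i + d i)]
    linarith
  · have h1 := hdiagnn hBB i
    simp only [Matrix.sub_apply] at h1
    rw [hsqdiag hGs, hsqdiag hBs] at h1
    refine le_trans (Finset.sum_le_sum fun j _ => ?_) ((sub_nonneg.1 h1).trans (hρ i))
    by_cases h : i = j
    · subst h; simp [hollow, sq_nonneg]
    · simp [hollow, h]
  -- A positive semidefinite matrix with diagonal at most ρ/κ has entries no larger; this is tested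
  -- on e_i ± e_j.
  · have hD : |(G - B) i j| ≤ ρ / κ := by
      have hs : (G - B) j i = (G - B) i j := by
        have h1 : B j i = B i j := congrFun (congrFun hBs i) j
        have h2 : G j i = G i j := congrFun (congrFun hGs i) j
        simp [h1, h2]
      have hq : ∀ σ : ℝ, 0 ≤ (G - B) i i + σ * (2 * (G - B) i j) + σ ^ 2 * (G - B) j j :=
        fun σ => by
          have h := hAB.dotProduct_mulVec_nonneg (Pi.single i 1 + Pi.single j σ)
          simp only [star_trivial, mulVec_add, add_dotProduct, dotProduct_add,
            single_dotProduct, mulVec_single, Pi.smul_apply, MulOpposite.op_one, one_smul,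
            col_apply, one_mul, MulOpposite.smul_eq_mul_unop, MulOpposite.unop_op, hs] at h
          linarith
      have hi := hloss i
      have hj := hloss j
      have hp := hq 1
      have hn := hq (-1)
      simp only [Matrix.sub_apply] at hp hn ⊢
      rw [abs_le]
      constructor <;> linarith
    simp only [hollow, of_apply, hij, if_false]
    calc |B i j| = |G i j - (G - B) i j| := by simp
      _ ≤ |G i j| + |(G - B) i j| := abs_sub _ _
      _ ≤ _ := by linarith

end Conditioning

/-! ### Choice of constants for large log(N/ε). -/

section Asymptotics

open Matrix

/-- Entries of size `r` are harmless: either there are few of them, or `r` is tiny. -/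
theorem entry_bound_dichotomy {A B Q r : ℝ} (hA : 1 ≤ A) (hB : 1 ≤ B) (hQ : 1 ≤ Q)
    (hr : r ≤ Q / (A * B ^ 3) + Q / B ^ 8) :
    A ^ 2 * r ≤ 1 / (5000 * B ^ 2) ∨ r ≤ 20000 * Q ^ 2 / B ^ 4 := by
  have hA0 : 0 < A := by linarith
  have hB0 : 0 < B := by linarith
  have hQ0 : 0 < Q := by linarith
  -- With A = √k and B = √L, the first case is k small against L, where k entries add up to little;
  -- in the second, 1/A is at most a constant over B.
  rcases le_total (10000 * Q * A) B with h | h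
  · left
    have e : A ^ 2 * (Q / (A * B ^ 3) + Q / B ^ 8) = (Q * A / B + (Q * A) * (A / B ^ 6)) / B ^ 2 := by
      field_simp
    have h1 : Q * A / B ≤ 1 / 10000 := by
      rw [div_le_iff₀ hB0]; linarith
    have h2 : Q * A * (A / B ^ 6) ≤ 1 / 10000 := by
      have h3 : A ≤ B := by nlinarith
      have h4 : A / B ^ 6 ≤ 1 / B := by
        rw [div_le_div_iff₀ (by positivity) hB0]
        have : B ^ 2 ≤ B ^ 6 := pow_le_pow_right₀ hB (by norm_num)
        nlinarith
      calc Q * A * (A / B ^ 6) ≤ Q * A * (1 / B) := mul_le_mul_of_nonneg_left h4 (by positivity)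
        _ = Q * A / B := by ring
        _ ≤ _ := h1
    calc A ^ 2 * r ≤ A ^ 2 * (Q / (A * B ^ 3) + Q / B ^ 8) :=
          mul_le_mul_of_nonneg_left hr (by positivity)
      _ = _ := e
      _ ≤ (1 / 5000) / B ^ 2 := by gcongr; linarith
      _ = _ := by field_simp
  · right
    have h1 : Q / (A * B ^ 3) ≤ 10000 * Q ^ 2 / B ^ 4 := by
      rw [div_le_div_iff₀ (by positivity) (by positivity)]
      have : Q * B ^ 4 = Q * B ^ 3 * B := by ring
      rw [this]
      calc Q * B ^ 3 * B ≤ Q * B ^ 3 * (10000 * Q * A) :=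
            mul_le_mul_of_nonneg_left h (by positivity)
        _ = _ := by ring
    have h2 : Q / B ^ 8 ≤ 10000 * Q ^ 2 / B ^ 4 := by
      refine div_le_div₀ (by positivity) (by nlinarith) (by positivity)
        (pow_le_pow_right₀ hB (by norm_num))
    calc r ≤ _ := hr
      _ ≤ 10000 * Q ^ 2 / B ^ 4 + 10000 * Q ^ 2 / B ^ 4 := add_le_add h1 h2
      _ = _ := by ring

-- If k r is small, no row can be long. Otherwise r = O(L⁻²), and since the order P and the inverse
-- threshold are both O(L), the exponent in the moment condition stays bounded: 5 · 20000 · 15000 =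
-- 1500000000.
open Classical in
theorem card_long_row_le_of_dichotomy {N m k P : ℕ} {Y : Matrix (Fin N) (Fin N) ℝ}
    {r K L Q : ℝ} (hr : ∀ i j, Y i j ^ 2 ≤ r) (hr0 : 0 ≤ r) (hK : 1 ≤ K) (hL : 1 ≤ L)
    (hm : 0 < m) (hN : 2 * k ≤ N) (hb : ∀ i, ∑ j, Y i j ^ 2 ≤ K * N / m)
    (hP : (P : ℝ) ≤ 5 * L)
    (hbig : K * k * (100000 * Real.exp (1500000000 * Q ^ 2) * L ^ 2) ≤ m)
    (hdich : k * r ≤ 1 / (5000 * L) ∨ r ≤ 20000 * Q ^ 2 / L ^ 2) :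
    (((Finset.univ.powersetCard k).filter fun I : Finset (Fin N) =>
      ∃ i, 1 / (5000 * L) < ∑ j ∈ I, Y i j ^ 2).card : ℝ) ≤
      N.choose k * (N * Real.exp (-P)) := by
  have hL0 : 0 < L := by linarith
  have hm0 : (0 : ℝ) < m := by exact_mod_cast hm
  rcases hdich with h | h
  · rw [Finset.filter_false_of_mem]
    · rw [Finset.card_empty, Nat.cast_zero]; positivity
    · rintro I hI ⟨i, hi⟩
      refine absurd hi (not_lt.2 ?_)
      calc ∑ j ∈ I, Y i j ^ 2 ≤ ∑ _j ∈ I, r := Finset.sum_le_sum fun j _ => hr i j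
        _ = k * r := by rw [Finset.sum_const, (Finset.mem_powersetCard.1 hI).2, nsmul_eq_mul]
        _ ≤ _ := h
  · have hNk : (2 : ℝ) * k ≤ N := by exact_mod_cast hN
    have he : Real.exp 1 ≤ 3 := Real.exp_one_lt_three.le
    have hT : 1 / (15000 * L) ≤ 1 / (5000 * L) / Real.exp 1 := by
      rw [div_div]
      exact one_div_le_one_div_of_le (by positivity) (by nlinarith)
    have := card_long_row_le (ι := Fin N) (Y := Y) (r := r) (b := K * N / m)
      (m₀ := 2 * (K * k) / m) (t := 1 / (5000 * L)) (k := k) (P := P) hr hr0 (by positivity) hb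
      (by positivity) (by simp; omega) ?_ ?_
    · simpa using this
    · rw [Fintype.card_fin]
      have e1 : K * N / m * k = (K * k / m) * N := by ring
      have e2 : 2 * (K * k) / m * ((N : ℝ) + 1 - k) = (K * k / m) * (2 * (N + 1 - k)) := by ring
      rw [e1, e2]
      exact mul_le_mul_of_nonneg_left (by linarith) (by positivity)
    · have hexp : P * r / (1 / (5000 * L) / Real.exp 1) ≤ 1500000000 * Q ^ 2 := by
        calc P * r / (1 / (5000 * L) / Real.exp 1) ≤ P * r / (1 / (15000 * L)) := by gcongr
          _ = P * r * (15000 * L) := by field_simp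
          _ ≤ (5 * L) * (20000 * Q ^ 2 / L ^ 2) * (15000 * L) := by gcongr
          _ = _ := by field_simp; ring
      refine le_trans ?_ hT
      calc 2 * (K * k) / m * Real.exp (P * r / (1 / (5000 * L) / Real.exp 1))
          ≤ 2 * (K * k) / m * Real.exp (1500000000 * Q ^ 2) := by gcongr
        _ ≤ 1 / (15000 * L) := by
            rw [div_mul_eq_mul_div, div_le_div_iff₀ hm0 (by positivity), one_mul]
            refine le_trans ?_ hbig
            have h0 : 0 ≤ K * k * Real.exp (1500000000 * Q ^ 2) := by positivity
            have hLL : L ≤ L ^ 2 := by nlinarith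
            nlinarith [mul_le_mul_of_nonneg_left hLL h0, mul_nonneg h0 hL0.le]

open Classical in
theorem card_not_wellConditioned_le_of_large (C₁ K c : ℝ) (hK : 1 ≤ K) (hc : 0 < c) :
    ∃ L₀ : ℝ, 1 ≤ L₀ ∧ ∀ (m N k : ℕ) (L : ℝ) (Φ : Matrix (Fin m) (Fin N) ℝ), L₀ ≤ L → 1 ≤ k →
      m ≤ N → c * (k * L ^ 3) ≤ m → (∀ j, (Φᵀ * Φ) j j = 1) →
      (∀ i j, i ≠ j → (Φᵀ * Φ) i j ^ 2 ≤ C₁ ^ 2 / √m) →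
      (∀ i, ∑ j, (Φᵀ * Φ) i j ^ 2 ≤ K * N / m) →
      k ≤ N ∧ (((Finset.univ.powersetCard k).filter fun I =>
        ¬ WellConditioned Φ (1 / (5000 * L)) I).card : ℝ) ≤
        4 * (N.choose k * (N * Real.exp (-(4 * L)))) := by
  -- Since √m ≥ √c √k L^{3/2}, the coherence bound gives squared entries of order Q/(√k L^{3/2}).
  set Q : ℝ := 2 * C₁ ^ 2 / √c + 1 with hQ
  have hQ1 : 1 ≤ Q := by
    have : 0 ≤ 2 * C₁ ^ 2 / √c := by positivity
    linarith
  set E := Real.exp (1500000000 * Q ^ 2) with hE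
  have hE1 : 1 ≤ E := Real.one_le_exp (by positivity)
  -- Chosen so that c L ≥ 100000 K E: one of the three logarithms in m ≥ c k L³ absorbs all
  -- constants.
  refine ⟨1 + 100000 * K * E / c, by
    have : 0 ≤ 100000 * K * E / c := by positivity
    linarith, ?_⟩
  intro m N k L Φ hL hk hmN hcm hdiag hcoh hrow
  have hL1 : 1 ≤ L := le_trans (by
    have : 0 ≤ 100000 * K * E / c := by positivity
    linarith) hL
  have hL0 : 0 < L := by linarith
  have hkR : (1 : ℝ) ≤ k := by exact_mod_cast hk
  have hk0 : (0 : ℝ) < k := by linarith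
  have hmR0 : (0 : ℝ) < m := lt_of_lt_of_le (by positivity) hcm
  have hm0 : 0 < m := by exact_mod_cast hmR0
  have hmNR : (m : ℝ) ≤ N := by exact_mod_cast hmN
  have hN0 : (0 : ℝ) < N := hmR0.trans_le hmNR
  have hcL : 100000 * K * E ≤ c * L := by
    have h : 100000 * K * E / c ≤ L := by linarith
    rw [div_le_iff₀ hc] at h
    linarith
  have hbig : K * k * (100000 * E * L ^ 2) ≤ m := by
    refine le_trans ?_ hcm
    have : c * (k * L ^ 3) = (c * L) * (k * L ^ 2) := by ring
    rw [this]
    calc K * k * (100000 * E * L ^ 2) = (100000 * K * E) * (k * L ^ 2) := by ring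
      _ ≤ _ := mul_le_mul_of_nonneg_right hcL (by positivity)
  have hbig' : K * k * (100000 * L ^ 2) ≤ m := by
    refine le_trans ?_ hbig
    have h0 : 0 ≤ K * k * (100000 * L ^ 2) := by positivity
    calc K * k * (100000 * L ^ 2) ≤ K * k * (100000 * L ^ 2) * E :=
          le_mul_of_one_le_right h0 hE1
      _ = _ := by ring
  have hLsq : 1 ≤ L ^ 2 := one_le_pow₀ hL1
  have hkm : 100000 * (k : ℝ) ≤ m := by
    refine le_trans ?_ hbig'
    have h1 : (k : ℝ) ≤ K * k := le_mul_of_one_le_left hk0.le hK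
    have h2 : K * k ≤ K * k * L ^ 2 := le_mul_of_one_le_right (by positivity) hLsq
    linarith
  have hNk : 2 * k ≤ N := by
    have : (2 : ℝ) * k ≤ N := by linarith
    exact_mod_cast this
  have hNkR : (2 : ℝ) * k ≤ N := by exact_mod_cast hNk
  refine ⟨by omega, ?_⟩
  set P := ⌈4 * L⌉₊ with hP
  have hP4 : 4 * L ≤ P := Nat.le_ceil _
  have hP5 : (P : ℝ) ≤ 5 * L := by
    have := (Nat.ceil_lt_add_one (by positivity : 0 ≤ 4 * L)).le
    linarith
  have hPpos : 0 < P := by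
    have : (0 : ℝ) < P := lt_of_lt_of_le (by positivity) hP4
    exact_mod_cast this
  set κ : ℝ := N / (1000 * k) with hκ
  have hκ0 : 0 < κ := by positivity
  have hκ1 : 1 ≤ κ := by
    rw [hκ, le_div_iff₀ (by positivity)]; linarith
  have hρκ : K * N / m / κ ≤ 1 / (100 * L ^ 2) := by
    have e : K * N / m / κ = 1000 * (K * k) / m := by
      rw [hκ]; field_simp
    rw [e, div_le_div_iff₀ hmR0 (by positivity)]
    linarith
  have hρκ4 : K * N / m ≤ κ / 4 := by
    have h1 : K * N / m / κ ≤ 1 / 4 := hρκ.trans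
      (one_div_le_one_div_of_le (by norm_num) (by linarith))
    rw [div_le_iff₀ hκ0] at h1
    linarith
  obtain ⟨Y, hYd, hYs, hlow, hYop, hYrow, hYent⟩ :=
    exists_hollow_minorant hdiag hκ1 hrow hρκ4
  -- From (g + w)² ≤ 2g² + 2w², with g the Gram entry and w the truncation error; it serves both the
  -- Gram matrix and `Y`.
  set r : ℝ := 2 * (C₁ ^ 2 / √m) + 2 * (1 / (100 * L ^ 2)) ^ 2 with hr
  have hr0 : 0 ≤ r := by positivity
  have hdich : k * r ≤ 1 / (5000 * L) ∨ r ≤ 20000 * Q ^ 2 / L ^ 2 := by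
    have hkA : √(k : ℝ) ^ 2 = k := Real.sq_sqrt hk0.le
    have hLB : √L ^ 2 = L := Real.sq_sqrt hL0.le
    have hA1 : 1 ≤ √(k : ℝ) := Real.one_le_sqrt.2 hkR
    have hB1 : 1 ≤ √L := Real.one_le_sqrt.2 hL1
    have h := entry_bound_dichotomy (A := √(k : ℝ)) (B := √L) (Q := Q) (r := r) hA1 hB1 hQ1 ?_
    · have hLB4 : √L ^ 4 = L ^ 2 := by rw [← hLB]; ring_nf; simp
      rwa [hkA, hLB, hLB4] at h
    · have hsm : √c * (√(k : ℝ) * √L ^ 3) ≤ √m := by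
        refine Real.le_sqrt_of_sq_le (le_trans (le_of_eq ?_) hcm)
        rw [mul_pow, mul_pow, hkA, Real.sq_sqrt hc.le, ← pow_mul, mul_comm 3 2, pow_mul, hLB]
      have hsc : 0 < √c := Real.sqrt_pos.2 hc
      have h1 : 2 * (C₁ ^ 2 / √m) ≤ Q / (√(k : ℝ) * √L ^ 3) := by
        calc 2 * (C₁ ^ 2 / √m) ≤ 2 * (C₁ ^ 2 / (√c * (√(k : ℝ) * √L ^ 3))) := by gcongr
          _ = (2 * C₁ ^ 2 / √c) / (√(k : ℝ) * √L ^ 3) := by field_simp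
          _ ≤ _ := by gcongr; linarith
      have h2 : 2 * (1 / (100 * L ^ 2)) ^ 2 ≤ Q / √L ^ 8 := by
        have hB8 : √L ^ 8 = L ^ 4 := by
          rw [show (8 : ℕ) = 2 * 4 by norm_num, pow_mul, hLB]
        rw [hB8]
        have e : 2 * (1 / (100 * L ^ 2)) ^ 2 = (1 / 5000) / L ^ 4 := by field_simp; norm_num
        rw [e]
        gcongr
        linarith
      linarith
  have hYr : ∀ i j, Y i j ^ 2 ≤ r := fun i j => by
    by_cases hij : i = j
    · subst hij; rw [hYd]; simpa using hr0
    · have h1 := (hYent i j hij).trans (add_le_add_right hρκ _)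
      have h2 := hcoh i j hij
      rw [← sq_abs] at h2 ⊢
      set g := |(Φᵀ * Φ) i j|
      set w := 1 / (100 * L ^ 2)
      have h3 : |Y i j| ^ 2 ≤ (g + w) ^ 2 := pow_le_pow_left₀ (abs_nonneg _) h1 2
      nlinarith [sq_nonneg (g - w)]
  have hXr : ∀ i j, hollow (Φᵀ * Φ) i j ^ 2 ≤ r := fun i j => by
    by_cases hij : i = j
    · subst hij; simpa [hollow] using hr0
    · have h2 := hcoh i j hij
      have h3 : 0 ≤ C₁ ^ 2 / √m := by positivity
      have h4 : 0 ≤ 2 * (1 / (100 * L ^ 2)) ^ 2 := by positivity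
      simp only [hollow, of_apply, hij, if_false]
      linarith
  have hXrow : ∀ i, ∑ j, hollow (Φᵀ * Φ) i j ^ 2 ≤ K * N / m := fun i => by
    refine le_trans (Finset.sum_le_sum fun j _ => ?_) (hrow i)
    by_cases hij : i = j
    · subst hij; simp [hollow, sq_nonneg]
    · simp [hollow, hij]
  have he3 : Real.exp 1 ≤ 3 := Real.exp_one_lt_three.le
  have he0 : 0 < Real.exp 1 := Real.exp_pos 1
  -- Here `m₀` is 2bk/N, equal to 0.048 t for κ = N/(1000 k); this leaves room for e² below the
  -- threshold t = N/(6000 k).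
  have hcol := card_large_columns_le (Y := Y) hYs (r := K * N / m) (b := 4 * κ ^ 2)
    (m₀ := 8 * κ ^ 2 * k / N) (t := N / (6000 * k)) (k := k) (P := P) (by positivity) hYrow
    (by positivity) hYop (by positivity) (by simp; omega) (by
      rw [Fintype.card_fin]
      have e : 8 * κ ^ 2 * k / N * ((N : ℝ) + 1 - k) =
        (4 * κ ^ 2 * k) * (2 * ((N : ℝ) + 1 - k) / N) := by ring
      rw [e]
      refine le_mul_of_one_le_right (by positivity) ?_
      rw [le_div_iff₀ hN0]; linarith) (by
      have hexp : P * (K * N / m) / (N / (6000 * k) / Real.exp 1) ≤ 1 := by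
        have e : P * (K * N / m) / (N / (6000 * k) / Real.exp 1) =
            P * Real.exp 1 * (6000 * (K * k)) / m := by field_simp
        rw [e, div_le_one hmR0]
        refine le_trans ?_ hbig'
        calc P * Real.exp 1 * (6000 * (K * k)) ≤ (5 * L) * 3 * (6000 * (K * k)) := by gcongr
          _ = K * k * (90000 * L) := by ring
          _ ≤ K * k * (100000 * L ^ 2) := by
              refine mul_le_mul_of_nonneg_left ?_ (by positivity)
              nlinarith
      calc 8 * κ ^ 2 * k / N * Real.exp (P * (K * N / m) / (N / (6000 * k) / Real.exp 1))
          ≤ 8 * κ ^ 2 * k / N * Real.exp 1 := by gcongr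
        _ ≤ 8 * κ ^ 2 * k / N * 3 := by gcongr
        _ = (N / (6000 * k)) * (144 / 1000) := by rw [hκ]; field_simp; norm_num
        _ ≤ (N / (6000 * k)) * (1 / 3) :=
            mul_le_mul_of_nonneg_left (by norm_num) (by positivity)
        _ ≤ (N / (6000 * k)) * (1 / Real.exp 1) := by gcongr
        _ = _ := by ring)
  -- The column bound N/(6000 k) on k sampled rows gives mean scale 1/3000, and P r / T ≤ 1 costs a
  -- factor e < 3, hence T = 1/1000. The decoupled tail then closes because 16/1000 ≤ 1/(16 e).
  have hreg := card_regular_large_quadForm_mul_pow_le (Y := Y) hYd (r := 1 / (5000 * L))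
    (b := N / (6000 * k)) (m₀ := 1 / 3000) (T := 1 / 1000) (s := 1 / 4) (k := k) (P := P)
    (by positivity) (by positivity) (by norm_num) (by norm_num) (by simp; omega) hPpos (by
      rw [Fintype.card_fin]
      have e : (N : ℝ) / (6000 * k) * k = N / 6000 := by field_simp
      rw [e]; linarith) (by
      have hexp : P * (1 / (5000 * L)) / (1 / 1000) ≤ 1 := by
        have e : P * (1 / (5000 * L)) / (1 / 1000) = P / (5 * L) := by field_simp; norm_num
        rw [e, div_le_one (by positivity)]
        exact hP5
      calc 1 / 3000 * Real.exp (P * (1 / (5000 * L)) / (1 / 1000)) ≤ 1 / 3000 * Real.exp 1 := by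
            gcongr
        _ ≤ 1 / 1000 := by linarith)
  rw [Fintype.card_fin] at hcol hreg
  rw [pow_mul, show ((1 : ℝ) / 4) ^ 2 = 1 / 16 by norm_num] at hreg
  have hexpP : Real.exp (-P) ≤ Real.exp (-(4 * L)) := Real.exp_le_exp.2 (by linarith)
  have hreg' := le_mul_exp_neg_of_mul_pow_le (A := N.choose k * N) (P := P) (t := 1 / 16)
    (by norm_num) (hreg.trans (by
      calc (16 : ℝ) ^ P * (N.choose k * (N * (1 / 1000) ^ P))
          = N.choose k * N * (16 * (1 / 1000)) ^ P := by rw [mul_pow]; ring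
        _ ≤ N.choose k * N * (1 / 16 / Real.exp 1) ^ P := by
            gcongr
            rw [le_div_iff₀ he0]; linarith))
  refine (card_not_wellConditioned_le (D := N.choose k * (N * Real.exp (-P))) hlow
    (card_long_row_le_of_dichotomy hXr hr0 hK hL1 hm0 hNk hXrow hP5 hbig hdich)
    (card_long_row_le_of_dichotomy hYr hr0 hK hL1 hm0 hNk hYrow hP5 hbig hdich)
    (hcol.trans (le_of_eq (by ring))) (hreg'.trans (le_of_eq (by ring)))).trans ?_
  gcongr

/-! ### Coherence hypotheses as Gram matrix bounds, and the conclusion. -/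

theorem gram_apply_self {m N : ℕ} {Φ : Matrix (Fin m) (Fin N) ℝ} (h : UnitNormColumns Φ)
    (j : Fin N) : (Φᵀ * Φ) j j = 1 := by
  have h1 := h j
  have h2 : ‖WithLp.toLp 2 (Φ.col j)‖ ^ 2 = 1 := by rw [h1]; norm_num
  rw [EuclideanSpace.real_norm_sq_eq] at h2
  rw [← h2, mul_apply]
  exact Finset.sum_congr rfl fun a _ => by simp [sq]

theorem gram_sq_le {m N : ℕ} {Φ : Matrix (Fin m) (Fin N) ℝ} {C₁ : ℝ}
    (h : mutualCoherence Φ ≤ C₁ * (m : ℝ) ^ (-(1 / 4) : ℝ)) {i j : Fin N} (hij : i ≠ j) :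
    (Φᵀ * Φ) i j ^ 2 ≤ C₁ ^ 2 / √m := by
  have h1 : |(Φᵀ * Φ) i j| ≤ C₁ * (m : ℝ) ^ (-(1 / 4) : ℝ) :=
    le_trans (le_ciSup (f := fun p : {p : Fin N × Fin N // p.1 ≠ p.2} =>
      pairCoherence Φ p.1.1 p.1.2) (Set.finite_range _).bddAbove ⟨(i, j), hij⟩) h
  rw [← sq_abs]
  refine (pow_le_pow_left₀ (abs_nonneg _) h1 2).trans (le_of_eq ?_)
  have e : ((m : ℝ) ^ (-(1 / 4) : ℝ)) ^ 2 = (√m)⁻¹ := by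
    rw [← Real.rpow_natCast, ← Real.rpow_mul (Nat.cast_nonneg m), Real.sqrt_eq_rpow,
      ← Real.rpow_neg (Nat.cast_nonneg m)]
    norm_num
  rw [mul_pow, e, div_eq_mul_inv]

theorem sum_gram_sq_le {m N : ℕ} {Φ : Matrix (Fin m) (Fin N) ℝ} {C₂ : ℝ}
    (hunit : UnitNormColumns Φ) (h : meanSquareCoherence Φ ≤ C₂ * (m : ℝ)⁻¹) (hm : 0 < m)
    (hmN : m ≤ N) (hN : 2 ≤ N) (i : Fin N) : ∑ j, (Φᵀ * Φ) i j ^ 2 ≤ (1 + |C₂|) * N / m := by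
  have hmR : (0 : ℝ) < m := by exact_mod_cast hm
  have hmN' : (m : ℝ) ≤ N := by exact_mod_cast hmN
  have hN' : (2 : ℝ) ≤ N := by exact_mod_cast hN
  have h1 : 1 / ((N : ℝ) - 1) * ∑ j ∈ Finset.univ.erase i, pairCoherence Φ j i ^ 2 ≤
      C₂ * (m : ℝ)⁻¹ :=
    le_trans (le_ciSup (f := fun j : Fin N => 1 / ((N : ℝ) - 1) *
      ∑ i ∈ Finset.univ.erase j, pairCoherence Φ i j ^ 2) (Set.finite_range _).bddAbove i) h
  have e : ∑ j ∈ Finset.univ.erase i, pairCoherence Φ j i ^ 2 =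
      ∑ j ∈ Finset.univ.erase i, (Φᵀ * Φ) i j ^ 2 := by
    refine Finset.sum_congr rfl fun j _ => ?_
    rw [pairCoherence, sq_abs, dotProduct_comm]
    rfl
  rw [e, one_div, inv_mul_le_iff₀ (by linarith)] at h1
  -- The diagonal term 1 is absorbed by N/m ≥ 1, hence the constant 1 + |C₂|.
  rw [← Finset.add_sum_erase _ _ (Finset.mem_univ i), gram_apply_self hunit]
  have h2 : ((N : ℝ) - 1) * (C₂ * (m : ℝ)⁻¹) ≤ N * (|C₂| * (m : ℝ)⁻¹) := by
    have h3 : C₂ * (m : ℝ)⁻¹ ≤ |C₂| * (m : ℝ)⁻¹ :=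
      mul_le_mul_of_nonneg_right (le_abs_self _) (by positivity)
    have h4 : 0 ≤ |C₂| * (m : ℝ)⁻¹ := by positivity
    nlinarith
  have h3 : 1 ≤ (N : ℝ) / m := by rwa [one_le_div hmR]
  have e2 : (1 + |C₂|) * N / m = N / m + N * (|C₂| * (m : ℝ)⁻¹) := by
    field_simp
  rw [e2]
  linarith

end Asymptotics

end SparseRecovery

theorem mainTheorem4 (C₁ C₂ C₃ c C : ℝ) (hc : 0 < c) :
    ∃ N₀ : ℕ, ∀ (m N k : ℕ) (ε : ℝ) (Φ : Matrix (Fin m) (Fin N) ℝ),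
      N₀ ≤ N → m ≤ N → 1 ≤ k → 0 < ε → (k : ℝ) < 1 / ε →
      SparseRecovery.UnitNormColumns Φ →
      SparseRecovery.mutualCoherence Φ ≤ C₁ * (m : ℝ) ^ (-(1 / 4) : ℝ) →
      SparseRecovery.meanSquareCoherence Φ ≤ C₂ * (m : ℝ)⁻¹ →
      SparseRecovery.specNorm Φ ≤ C₃ * Real.sqrt ((N : ℝ) / k) →
      c * (k * Real.log (N / ε) ^ 3) ≤ m →
      (m : ℝ) ≤ C * (k * Real.log (N / ε) ^ 3) →
      ∀ {Ω : Type*} [MeasurableSpace Ω] (P : MeasureTheory.Measure Ω)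
        [MeasureTheory.IsProbabilityMeasure P] (x : Ω → Fin N → ℝ),
        SparseRecovery.IsGenericRandomSignal P k x →
        (∀ᵐ ω ∂P, SparseRecovery.IsSparse k (x ω)) →
        P {ω | ¬ SparseRecovery.BPRecovers Φ (x ω)} ≤ ENNReal.ofReal ε := by
  classical
  obtain ⟨L₀, hL₀, hcount⟩ := SparseRecovery.card_not_wellConditioned_le_of_large C₁ (1 + |C₂|) c
    (by linarith [abs_nonneg C₂]) hc
  refine ⟨⌈Real.exp L₀⌉₊ + 2, ?_⟩
  intro m N k ε Φ hN hmN hk hε hkε hunit hμ hμ2 _ hcm _ Ω _ P _ x hx hsparse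
  have hkR : (1 : ℝ) ≤ k := by exact_mod_cast hk
  -- The conditions k ≥ 1 and k < 1/ε force ε < 1, so L ≥ log N is large as soon as N is.
  have hε1 : ε ≤ 1 := by
    rw [lt_div_iff₀ hε] at hkε
    nlinarith
  have hNR : Real.exp L₀ ≤ N :=
    (Nat.le_ceil _).trans (by exact_mod_cast (Nat.le_add_right _ 2).trans hN)
  have hN0 : (0 : ℝ) < N := (Real.exp_pos _).trans_le hNR
  set L := Real.log (N / ε) with hL
  have hexpL : Real.exp L = N / ε := Real.exp_log (by positivity)
  have hLL : L₀ ≤ L := by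
    rw [hL, Real.le_log_iff_exp_le (by positivity)]
    refine hNR.trans ?_
    rw [le_div_iff₀ hε]
    nlinarith
  have hL1 : 1 ≤ L := hL₀.trans hLL
  have hm : 0 < m := by
    have : (0 : ℝ) < m := lt_of_lt_of_le (by positivity) hcm
    exact_mod_cast this
  obtain ⟨hkN, hbad⟩ := hcount m N k L Φ hLL hk hmN hcm
    (SparseRecovery.gram_apply_self hunit) (fun i j => SparseRecovery.gram_sq_le hμ)
    (SparseRecovery.sum_gram_sq_le hunit hμ2 hm hmN (by omega))
  have hmeas := SparseRecovery.measure_not_bpRecovers_le (Φ := Φ) (a := 1 / (5000 * L))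
    (δ := 4 * (N * Real.exp (-(4 * L)))) hkN (by positivity)
    (hbad.trans (le_of_eq (by ring))) hx hsparse
  refine hmeas.trans (ENNReal.ofReal_le_ofReal ?_)
  have e1 : -1 / (8 * (1 / (5000 * L))) ≤ -(4 * L) := by
    have : -1 / (8 * (1 / (5000 * L))) = -(625 * L) := by field_simp; norm_num
    rw [this]; linarith
  -- With N = ε e^L, four bad counts and two Hoeffding tails add up to at most 6 ε e^{-3L}, and L ≥
  -- 1 gives e^{-3L} ≤ 1/6.
  have hNε : N * Real.exp (-(4 * L)) = ε * Real.exp (-(3 * L)) := by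
    have : (N : ℝ) = ε * Real.exp L := by rw [hexpL]; field_simp
    rw [this, mul_assoc, ← Real.exp_add]
    ring_nf
  have h3 : Real.exp (-(3 * L)) ≤ 1 / 6 := by
    have h1 : Real.exp (-(3 * L)) ≤ Real.exp (-3) := Real.exp_le_exp.2 (by linarith)
    have h2 : Real.exp (-3) ≤ 1 / 6 := by
      rw [Real.exp_neg, ← one_div]
      refine one_div_le_one_div_of_le (by norm_num) ?_
      have : Real.exp 3 = Real.exp 1 ^ 3 := by rw [← Real.exp_nat_mul]; norm_num
      rw [this]
      calc (6 : ℝ) ≤ 2 ^ 3 := by norm_num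
        _ ≤ _ := pow_le_pow_left₀ (by norm_num) (by linarith [Real.add_one_le_exp (1 : ℝ)]) 3
    exact h1.trans h2
  calc 4 * (N * Real.exp (-(4 * L))) + N * (2 * Real.exp (-1 / (8 * (1 / (5000 * L)))))
      ≤ 4 * (N * Real.exp (-(4 * L))) + N * (2 * Real.exp (-(4 * L))) := by gcongr
    _ = 6 * (N * Real.exp (-(4 * L))) := by ring
    _ = 6 * (ε * Real.exp (-(3 * L))) := by rw [hNε]
    _ ≤ 6 * (ε * (1 / 6)) := by gcongr
    _ = ε := by ring
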